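/- Identify $\mathbb{R}^2$ with $\mathbb{C}$ and let $\mathcal{H}^1$ be the one-dimensional Hausdorff measure. The Painlevé length $\kappa(K)$ of a compact set $K\subset\mathbb{R}^2$ is the infimum of the numbers $\ell$ with the following property: for every open set $U\supset K$ there is an open set $V$ with $K\subset V\subset U$ such that $\partial V$ is a finite union of pairwise disjoint analytic Jordan curves of total length at most $\ell$. For integers $k\ge 2$ and $1\le j\le 2^k$ let $$f_{k,j}(z) = 2^{-k}z + (1-2^{-k})\,e^{j2^{1-k}\pi i}.$$ Let $K_1=\overline{B}(0,1)$ be the closed unit disc, for $k\ge 2$ let $$K_k=\bigcup_{(j_2,\dots,j_k)} f_{2,j_2}\circ f_{3,j_3}\circ\cdots\circ f_{k,j_k}(K_1),$$ where the union is over all tuples with $1\le j_i\le 2^i$ for $i=2,\dots,k$, and let $K=\bigcap_{k\ge 1}K_k$. Then $K_{k+1}\subset K_k$ for every $k\ge 1$, the set $K$ is compact and totally disconnected, $\mathcal{H}^1(K)=2$ and $\kappa(K)=2\pi$. Hence $\kappa(K)=\pi\,\mathcal{H}^1(K)$, so the constant $\pi$ in the general bound $\kappa(E)\le\pi\,\mathcal{H}^1(E)$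 for compact $E\subset\mathbb{R}^2$ is sharp: if $c\in[0,\infty]$ satisfies $\kappa(E)\le c\,\mathcal{H}^1(E)$ for every compact $E\subset\mathbb{R}^2$, then $c\ge\pi$. -/

import Mathlib

open MeasureTheory Set

open scoped ENNReal Real

namespace Painleve

/-- `γ` is a regular real-analytic parametrisation, of period `1`, of an analytic Jordan curve
in the plane `ℂ = ℝ²`; the curve itself is `range γ`. -/
structure IsAnalyticJordanCurve (γ : ℝ → ℂ) : Prop where
  analytic : AnalyticOnNhd ℝ γ univ
  periodic : Function.Periodic γ 1
  injOn : InjOn γ (Ico 0 1)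
  regular : ∀ t, deriv γ t ≠ 0

/-- The length of the closed curve `γ` of period `1`: the supremum of the lengths of inscribed
polygonal lines over one period. -/
noncomputable def curveLength (γ : ℝ → ℂ) : ℝ≥0∞ := eVariationOn γ (Icc 0 1)

/-- The boundary of `V` is a finite union of disjoint analytic Jordan curves of total length at
most `l`. -/
def HasAnalyticBoundaryOfLengthLE (V : Set ℂ) (l : ℝ≥0∞) : Prop :=
  ∃ (n : ℕ) (γ : Fin n → ℝ → ℂ),
    (∀ i, IsAnalyticJordanCurve (γ i)) ∧
    (∀ i j, i ≠ j → Disjoint (range (γ i)) (range (γ j))) ∧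
    frontier V = ⋃ i, range (γ i) ∧
    ∑ i, curveLength (γ i) ≤ l

/-- The Painlevé length `κ(K)` of a (compact) planar set `K`. -/
noncomputable def kappa (K : Set ℂ) : ℝ≥0∞ :=
  sInf {l : ℝ≥0∞ | ∀ U : Set ℂ, IsOpen U → K ⊆ U →
    ∃ V : Set ℂ, IsOpen V ∧ K ⊆ V ∧ V ⊆ U ∧ HasAnalyticBoundaryOfLengthLE V l}

/-- The similitude `f_{k,j}(z) = 2⁻ᵏ z + (1 - 2⁻ᵏ) exp(j 2^{1-k} π i)`. -/
noncomputable def f (k j : ℕ) (z : ℂ) : ℂ :=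
  (1 / 2 ^ k) * z + (1 - 1 / 2 ^ k) * Complex.exp (j * (2 / 2 ^ k) * π * Complex.I)

/-- `wordMap j k = f_{2,j₂} ∘ f_{3,j₃} ∘ ⋯ ∘ f_{k,j_k}`, which is the identity for `k ≤ 1`.
Only the values `j i` with `2 ≤ i ≤ k` matter. -/
noncomputable def wordMap (j : ℕ → ℕ) : ℕ → ℂ → ℂ
  | 0 => id
  | 1 => id
  | k + 2 => wordMap j (k + 1) ∘ f (k + 2) (j (k + 2))

/-- The union `K_k` of the construction balls of level `k` (used for `k ≥ 1`). -/
noncomputable def level (k : ℕ) : Set ℂ :=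
  ⋃ j ∈ {j : ℕ → ℕ | ∀ i, 2 ≤ i → i ≤ k → 1 ≤ j i ∧ j i ≤ 2 ^ i},
    wordMap j k '' Metric.closedBall 0 1

/-- The "circles of balls" set `K = ⋂_{k ≥ 1} K_k`. -/
noncomputable def circlesOfBalls : Set ℂ := ⋂ k ∈ {k : ℕ | 1 ≤ k}, level k

end Painleve

/-!
By Cauchy's formula the perimeter of the convex hull of a bounded planar set `A` is the integral of
its support function over all directions, here `hullPerimeter A`. It is at most `π * diam A`, and
for a closed curve it is at most the length of the curve.

Every generation of discs has total radius `1`. The key estimate says that a set `A` of small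
diameter has hull perimeter at least `2 * π * (1 - ε)` times the total radius of the discs of any
given later generation contained in `A`; it passes from a disc to the discs of the next generation
inside it, which are arranged along a regular polygon.

* If the sets of an open cover of `K` have small diameter, each disc of a late generation lies in
  one of them, so their hull perimeters have sum at least `2 * π * (1 - ε)`, and
  `hullPerimeter A ≤ π * diam A` yields `μH[1] K ≥ 2`.
* Suppose that `∂V` consists of short curves, `V ⊇ K` being close to `K`. Replacing the closed hulls
  of two curves that meet by the hull of their union does not increase the sum of the perimeters, so
  the curves lie in disjoint compact convex sets whose perimeters have sum at most the total length.
  The complement of these sets is connected, so they cover `V`, and `κ(K) ≥ 2 * π` follows.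

The discs of one generation give the bound `μH[1] K ≤ 2`, and slightly larger concentric discs give
`κ(K) ≤ 2 * π`.
-/

namespace Painleve

open Bornology Metric

/-- The scalar product with the unit vector `exp (θ I)`: the orthogonal projection of the plane
to the oriented line of direction `θ`. -/
noncomputable def proj (θ : ℝ) : ℂ →L[ℝ] ℝ := innerSL ℝ (Complex.exp (θ * Complex.I))

lemma proj_apply (θ : ℝ) (z : ℂ) : proj θ z = z.re * Real.cos θ + z.im * Real.sin θ := by
  simp [proj, innerSL_apply_apply, Complex.inner, Complex.exp_ofReal_mul_I_re,
    Complex.exp_ofReal_mul_I_im]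

lemma proj_eq_norm_mul_cos (θ : ℝ) (z : ℂ) : proj θ z = ‖z‖ * Real.cos (θ - z.arg) := by
  rw [Real.cos_sub, proj_apply]
  conv_lhs => rw [← Complex.norm_mul_cos_arg z, ← Complex.norm_mul_sin_arg z]
  ring

lemma abs_proj_le (θ : ℝ) (z : ℂ) : |proj θ z| ≤ ‖z‖ := by
  simpa [proj] using abs_real_inner_le_norm (Complex.exp (θ * Complex.I)) z

lemma proj_le (θ : ℝ) (z : ℂ) : proj θ z ≤ ‖z‖ := (le_abs_self _).trans (abs_proj_le θ z)

lemma proj_add_pi (θ : ℝ) (z : ℂ) : proj (θ + π) z = -proj θ z := by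
  simp only [proj_apply, Real.cos_add_pi, Real.sin_add_pi]
  ring

lemma proj_periodic (z : ℂ) : Function.Periodic (proj · z) (2 * π) := fun θ => by
  simp [proj_apply]

lemma proj_circleMap (θ : ℝ) (c : ℂ) (r φ : ℝ) :
    proj θ (circleMap c r φ) = proj θ c + r * Real.cos (θ - φ) := by
  rw [circleMap, map_add, proj_apply θ (r * _), Complex.re_ofReal_mul, Complex.im_ofReal_mul,
    Complex.exp_ofReal_mul_I_re, Complex.exp_ofReal_mul_I_im, Real.cos_sub]
  ring

lemma continuous_proj_left (z : ℂ) : Continuous (proj · z) := by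
  simp only [proj_apply]
  fun_prop

lemma integral_proj (z : ℂ) : ∫ θ in (0)..(2 * π), proj θ z = 0 := by
  simp only [proj_apply]
  rw [intervalIntegral.integral_add (by apply Continuous.intervalIntegrable; fun_prop)
    (by apply Continuous.intervalIntegrable; fun_prop)]
  simp

lemma integral_abs_cos : ∫ θ in (0)..(2 * π), |Real.cos θ| = 4 := by
  have hper : Function.Periodic (fun θ => |Real.cos θ|) π := fun θ => by simp [Real.cos_add_pi]
  have hhalf : ∀ a, ∫ θ in a..(a + π), |Real.cos θ| = 2 := fun a => by
    have hpos : EqOn (fun θ => |Real.cos θ|) Real.cos (uIcc (-(π / 2)) (π / 2)) := fun θ hθ => by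
      rw [uIcc_of_le (by linarith [Real.pi_pos])] at hθ
      exact abs_of_nonneg (Real.cos_nonneg_of_mem_Icc hθ)
    rw [hper.intervalIntegral_add_eq a (-(π / 2)), show -(π / 2) + π = π / 2 by ring,
      intervalIntegral.integral_congr hpos, integral_cos, Real.sin_neg, Real.sin_pi_div_two]
    norm_num
  have hint : ∀ a b, IntervalIntegrable (fun θ => |Real.cos θ|) volume a b :=
    (by fun_prop : Continuous fun θ => |Real.cos θ|).intervalIntegrable
  rw [← intervalIntegral.integral_add_adjacent_intervals (hint 0 (0 + π)) (hint (0 + π) (2 * π)),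
    hhalf, show 2 * π = 0 + π + π by ring, hhalf]
  norm_num

lemma integral_abs_proj (z : ℂ) : ∫ θ in (0)..(2 * π), |proj θ z| = 4 * ‖z‖ := by
  have hper : Function.Periodic (fun θ => |Real.cos θ|) (2 * π) := fun θ => by simp
  simp only [proj_eq_norm_mul_cos, abs_mul, abs_norm]
  rw [intervalIntegral.integral_const_mul,
    intervalIntegral.integral_comp_sub_right (fun θ => |Real.cos θ|),
    show 2 * π - z.arg = 0 - z.arg + 2 * π by ring, hper.intervalIntegral_add_eq _ 0, zero_add,
    integral_abs_cos, mul_comm]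

/-- The support function `h_A` of a planar set `A`, as a function of the direction. For unbounded
or empty `A` its values are the junk value `0` of `sSup`. -/
noncomputable def supportFunction (A : Set ℂ) (θ : ℝ) : ℝ := sSup (proj θ '' A)

/-- The integral of the support function over all directions. By Cauchy's formula this is the
perimeter of the convex hull (twice the length in the case of a segment). -/
noncomputable def hullPerimeter (A : Set ℂ) : ℝ := ∫ θ in (0)..(2 * π), supportFunction A θ

/-- The width `h_A(θ) + h_A(θ + π)` of a planar set `A` in the direction `θ`. -/
noncomputable def width (A : Set ℂ) (θ : ℝ) : ℝ := supportFunction A θ + supportFunction A (θ + π)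

section HullPerimeter

variable {A B : Set ℂ}

lemma proj_le_supportFunction (hA : IsBounded A) (θ : ℝ) {z : ℂ} (hz : z ∈ A) :
    proj θ z ≤ supportFunction A θ :=
  le_csSup ((proj θ).lipschitz.isBounded_image hA).bddAbove (mem_image_of_mem _ hz)

lemma supportFunction_le (hA : A.Nonempty) {θ b : ℝ} (h : ∀ z ∈ A, proj θ z ≤ b) :
    supportFunction A θ ≤ b :=
  csSup_le (hA.image _) (forall_mem_image.2 h)

lemma supportFunction_mono (hA : A.Nonempty) (hB : IsBounded B) (h : A ⊆ B) (θ : ℝ) :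
    supportFunction A θ ≤ supportFunction B θ :=
  supportFunction_le hA fun _ hz => proj_le_supportFunction hB θ (h hz)

lemma supportFunction_periodic (A : Set ℂ) : Function.Periodic (supportFunction A) (2 * π) :=
  fun θ => congrArg sSup (image_congr fun z _ => proj_periodic z θ)

lemma supportFunction_le_of_subset_closedBall (hA : A.Nonempty) {c : ℂ} {r : ℝ}
    (h : A ⊆ closedBall c r) (θ : ℝ) : supportFunction A θ ≤ proj θ c + r :=
  supportFunction_le hA fun z hz => by
    have := (proj_le θ (z - c)).trans (mem_closedBall_iff_norm.1 (h hz))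
    rw [map_sub] at this
    linarith

lemma continuous_supportFunction (hA : IsBounded A) (hne : A.Nonempty) :
    Continuous (supportFunction A) := by
  obtain ⟨R, hR⟩ := hA.exists_norm_le
  have hproj : ∀ θ φ, ∀ z ∈ A, proj θ z - proj φ z ≤ R * dist θ φ := fun θ φ z hz => by
    have hexp : ‖Complex.exp (θ * Complex.I) - Complex.exp (φ * Complex.I)‖ ≤ dist θ φ := by
      simpa [circleMap, dist_eq_norm] using (lipschitzWith_circleMap 0 1).dist_le_mul θ φ
    calc proj θ z - proj φ z
        = inner ℝ (Complex.exp (θ * Complex.I) - Complex.exp (φ * Complex.I)) z :=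
          by rw [inner_sub_left]; rfl
      _ ≤ ‖Complex.exp (θ * Complex.I) - Complex.exp (φ * Complex.I)‖ * ‖z‖ :=
          real_inner_le_norm _ _
      _ ≤ dist θ φ * R := by gcongr; exact hR z hz
      _ = R * dist θ φ := mul_comm _ _
  exact (LipschitzWith.of_le_add_mul' R fun θ φ => supportFunction_le hne fun z hz => by
    linarith [hproj θ φ z hz, proj_le_supportFunction hA φ hz]).continuous

lemma continuous_width (hA : IsBounded A) (hne : A.Nonempty) : Continuous (width A) :=
  (continuous_supportFunction hA hne).add
    ((continuous_supportFunction hA hne).comp (continuous_add_const π))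

lemma width_le (hne : A.Nonempty) {θ b : ℝ} (h : ∀ z ∈ A, ∀ w ∈ A, proj θ z - proj θ w ≤ b) :
    width A θ ≤ b := by
  have hz : ∀ z ∈ A, supportFunction A (θ + π) ≤ b - proj θ z := fun z hz =>
    supportFunction_le hne fun w hw => by linarith [proj_add_pi θ w, h z hz w hw]
  have := supportFunction_le (θ := θ) (b := b - supportFunction A (θ + π)) hne fun z hzA => by
    linarith [hz z hzA]
  unfold width
  linarith

lemma width_nonneg (hA : IsBounded A) (θ : ℝ) : 0 ≤ width A θ := by
  rcases A.eq_empty_or_nonempty with rfl | ⟨z, hz⟩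
  · simp [width, supportFunction]
  · have := proj_le_supportFunction hA (θ + π) hz
    rw [proj_add_pi] at this
    unfold width
    linarith [proj_le_supportFunction hA θ hz]

@[simp]
lemma hullPerimeter_empty : hullPerimeter ∅ = 0 := by simp [hullPerimeter, supportFunction]

lemma two_mul_hullPerimeter (hA : IsBounded A) (hne : A.Nonempty) :
    2 * hullPerimeter A = ∫ θ in (0)..(2 * π), width A θ := by
  have hc := continuous_supportFunction hA hne
  have hc' : Continuous fun θ => supportFunction A (θ + π) := hc.comp (continuous_add_const π)
  have hshift : ∫ θ in (0)..(2 * π), supportFunction A (θ + π) = hullPerimeter A := by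
    rw [intervalIntegral.integral_comp_add_right (supportFunction A), zero_add,
      add_comm (2 * π), (supportFunction_periodic A).intervalIntegral_add_eq _ 0, zero_add,
      hullPerimeter]
  unfold width
  rw [intervalIntegral.integral_add (hc.intervalIntegrable _ _) (hc'.intervalIntegrable _ _),
    hshift, two_mul, hullPerimeter]

lemma hullPerimeter_nonneg (hA : IsBounded A) : 0 ≤ hullPerimeter A := by
  rcases A.eq_empty_or_nonempty with rfl | hne
  · exact hullPerimeter_empty.ge
  · have := intervalIntegral.integral_nonneg (μ := volume) (a := 0) (b := 2 * π) (by positivity)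
      fun θ _ => width_nonneg hA θ
    linarith [two_mul_hullPerimeter hA hne]

lemma hullPerimeter_mono (hB : IsBounded B) (h : A ⊆ B) : hullPerimeter A ≤ hullPerimeter B := by
  rcases A.eq_empty_or_nonempty with rfl | hne
  · exact hullPerimeter_empty.trans_le (hullPerimeter_nonneg hB)
  · exact intervalIntegral.integral_mono (by positivity)
      ((continuous_supportFunction (hB.subset h) hne).intervalIntegrable _ _)
      ((continuous_supportFunction hB (hne.mono h)).intervalIntegrable _ _)
      (supportFunction_mono hne hB h)

lemma two_mul_hullPerimeter_le_integral (hA : IsBounded A) (hne : A.Nonempty) {g : ℝ → ℝ}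
    (hg : Continuous g) (h : ∀ θ, width A θ ≤ g θ) :
    2 * hullPerimeter A ≤ ∫ θ in (0)..(2 * π), g θ :=
  two_mul_hullPerimeter hA hne ▸ intervalIntegral.integral_mono (by positivity)
    ((continuous_width hA hne).intervalIntegrable _ _) (hg.intervalIntegrable _ _) h

lemma hullPerimeter_le_pi_mul_diam (hA : IsBounded A) : hullPerimeter A ≤ π * diam A := by
  rcases A.eq_empty_or_nonempty with rfl | hne
  · simp
  have hwidth : ∀ θ, width A θ ≤ diam A := fun θ => width_le hne fun z hz w hw => by
    rw [← map_sub]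
    exact (proj_le θ _).trans ((dist_eq_norm z w).ge.trans (dist_le_diam_of_mem hA hz hw))
  have := two_mul_hullPerimeter_le_integral hA hne continuous_const hwidth
  rw [intervalIntegral.integral_const, smul_eq_mul] at this
  linarith

lemma two_pi_mul_le_hullPerimeter_closedBall (c : ℂ) {r : ℝ} (hr : 0 ≤ r) :
    2 * π * r ≤ hullPerimeter (closedBall c r) := by
  have hproj : ∀ θ, proj θ c + r ≤ supportFunction (closedBall c r) θ := fun θ => by
    simpa [proj_circleMap] using
      proj_le_supportFunction isBounded_closedBall θ (circleMap_mem_closedBall c hr θ)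
  have hi := (continuous_proj_left c).intervalIntegrable (μ := volume) 0 (2 * π)
  calc 2 * π * r = ∫ θ in (0)..(2 * π), (proj θ c + r) := by
        rw [intervalIntegral.integral_add hi intervalIntegrable_const, integral_proj]
        simp
    _ ≤ _ := intervalIntegral.integral_mono (by positivity) (hi.add intervalIntegrable_const)
        ((continuous_supportFunction isBounded_closedBall
          ⟨c, mem_closedBall_self hr⟩).intervalIntegrable _ _) hproj

/-- Relative to a common point the support functions are nonnegative, so their sum dominates the
support function of the union. -/
lemma hullPerimeter_union_le (hA : IsBounded A) (hB : IsBounded B) (h : (A ∩ B).Nonempty) :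
    hullPerimeter (A ∪ B) ≤ hullPerimeter A + hullPerimeter B := by
  obtain ⟨x, hxA, hxB⟩ := h
  have hiA := (continuous_supportFunction hA ⟨x, hxA⟩).intervalIntegrable (μ := volume) 0 (2 * π)
  have hiB := (continuous_supportFunction hB ⟨x, hxB⟩).intervalIntegrable (μ := volume) 0 (2 * π)
  have hi := (continuous_proj_left x).intervalIntegrable (μ := volume) 0 (2 * π)
  have hne : (A ∪ B).Nonempty := ⟨x, .inl hxA⟩
  calc hullPerimeter (A ∪ B)
      ≤ ∫ θ in (0)..(2 * π), (supportFunction A θ + supportFunction B θ - proj θ x) := by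
        refine intervalIntegral.integral_mono (by positivity)
          ((continuous_supportFunction (hA.union hB) hne).intervalIntegrable _ _)
          ((hiA.add hiB).sub hi) fun θ => supportFunction_le hne ?_
        have hAx := proj_le_supportFunction hA θ hxA
        have hBx := proj_le_supportFunction hB θ hxB
        rintro z (hz | hz)
        · linarith [proj_le_supportFunction hA θ hz]
        · linarith [proj_le_supportFunction hB θ hz]
    _ = hullPerimeter A + hullPerimeter B := by
        rw [intervalIntegral.integral_sub (hiA.add hiB) hi, intervalIntegral.integral_add hiA hiB,
          integral_proj, sub_zero]
        rfl

lemma supportFunction_closedConvexHull (hA : IsBounded A) :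
    supportFunction (closedConvexHull ℝ A) = supportFunction A := by
  rcases A.eq_empty_or_nonempty with rfl | hne
  · rw [closedConvexHull_eq_closure_convexHull, convexHull_empty, closure_empty]
  funext θ
  have hsub : closedConvexHull ℝ A ⊆ {z | proj θ z ≤ supportFunction A θ} :=
    closedConvexHull_min (fun _ hz => proj_le_supportFunction hA θ hz)
      (convex_halfSpace_le (proj θ).isLinear _)
      (isClosed_le (proj θ).continuous continuous_const)
  refine le_antisymm (supportFunction_le (hne.mono subset_closedConvexHull) hsub) ?_
  refine supportFunction_mono hne ?_ subset_closedConvexHull θ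
  rw [closedConvexHull_eq_closure_convexHull]
  exact (isBounded_convexHull.2 hA).closure

lemma hullPerimeter_closedConvexHull (hA : IsBounded A) :
    hullPerimeter (closedConvexHull ℝ A) = hullPerimeter A := by
  rw [hullPerimeter, supportFunction_closedConvexHull hA, hullPerimeter]

lemma width_add_width_add_abs_proj_le (hA : IsBounded A) {A₁ A₂ : Set ℂ} (h₁ : A₁ ⊆ A)
    (h₂ : A₂ ⊆ A) (hne₁ : A₁.Nonempty) (hne₂ : A₂.Nonempty) {c₁ c₂ : ℂ} {ρ : ℝ}
    (hc₁ : A₁ ⊆ closedBall c₁ ρ) (hc₂ : A₂ ⊆ closedBall c₂ ρ) (θ : ℝ) :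
    width A₁ θ + width A₂ θ + |proj θ (c₂ - c₁)| ≤ width A θ + 2 * ρ := by
  have e₁ := supportFunction_le_of_subset_closedBall hne₁ hc₁
  have e₂ := supportFunction_le_of_subset_closedBall hne₂ hc₂
  have m₁ := supportFunction_mono hne₁ hA h₁
  have m₂ := supportFunction_mono hne₂ hA h₂
  have f₁ := e₁ (θ + π)
  have f₂ := e₂ (θ + π)
  rw [proj_add_pi] at f₁ f₂
  unfold width
  rcases abs_cases (proj θ (c₂ - c₁)) with ⟨h, -⟩ | ⟨h, -⟩ <;> rw [h, map_sub]
  · linarith [e₁ θ, m₁ (θ + π), m₂ θ]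
  · linarith [e₂ θ, m₁ θ, m₂ (θ + π)]

lemma hullPerimeter_add_le (hA : IsBounded A) {A₁ A₂ : Set ℂ} (h₁ : A₁ ⊆ A) (h₂ : A₂ ⊆ A)
    (hne₁ : A₁.Nonempty) (hne₂ : A₂.Nonempty) {c₁ c₂ : ℂ} {ρ : ℝ} (hc₁ : A₁ ⊆ closedBall c₁ ρ)
    (hc₂ : A₂ ⊆ closedBall c₂ ρ) :
    hullPerimeter A₁ + hullPerimeter A₂ + 2 * ‖c₂ - c₁‖ ≤ hullPerimeter A + 2 * π * ρ := by
  have hb₁ := hA.subset h₁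
  have hb₂ := hA.subset h₂
  have hne := hne₁.mono h₁
  have i := (continuous_width hA hne).intervalIntegrable (μ := volume) 0 (2 * π)
  have i₁ := (continuous_width hb₁ hne₁).intervalIntegrable (μ := volume) 0 (2 * π)
  have i₂ := (continuous_width hb₂ hne₂).intervalIntegrable (μ := volume) 0 (2 * π)
  have i₃ := (continuous_proj_left (c₂ - c₁)).abs.intervalIntegrable (μ := volume) 0 (2 * π)
  have := intervalIntegral.integral_mono (by positivity) ((i₁.add i₂).add i₃)
    (i.add intervalIntegrable_const)
    (width_add_width_add_abs_proj_le hA h₁ h₂ hne₁ hne₂ hc₁ hc₂)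
  rw [intervalIntegral.integral_add (i₁.add i₂) i₃, intervalIntegral.integral_add i₁ i₂,
    intervalIntegral.integral_add i intervalIntegrable_const, integral_abs_proj,
    ← two_mul_hullPerimeter hA hne, ← two_mul_hullPerimeter hb₁ hne₁,
    ← two_mul_hullPerimeter hb₂ hne₂, intervalIntegral.integral_const, smul_eq_mul] at this
  linarith

end HullPerimeter

section Curves

lemma two_mul_abs_sub_le_sum_abs_sub (x : ℕ → ℝ) {n i j : ℕ} (hx : x n = x 0) (hi : i ≤ n)
    (hj : j ≤ n) : 2 * |x j - x i| ≤ ∑ l ∈ Finset.range n, |x (l + 1) - x l| := by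
  wlog hij : i ≤ j generalizing i j
  · rw [abs_sub_comm]
    exact this hj hi (le_of_not_ge hij)
  have tel : ∀ a b, a ≤ b → |x b - x a| ≤ ∑ l ∈ Finset.Ico a b, |x (l + 1) - x l| :=
    fun a b hab => Finset.sum_Ico_sub x hab ▸ Finset.abs_sum_le_sum_abs _ _
  have hback : |x j - x i| ≤ |x i - x 0| + |x n - x j| := by
    have := abs_sub_le (x j) (x 0) (x i)
    rw [hx]
    linarith [abs_sub_comm (x j) (x 0), abs_sub_comm (x 0) (x i)]
  rw [Finset.range_eq_Ico, ← Finset.sum_Ico_consecutive _ (Nat.zero_le i) hi,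
    ← Finset.sum_Ico_consecutive _ hij hj]
  linarith [tel 0 i (Nat.zero_le i), tel i j hij, tel j n hj]

lemma hullPerimeter_image_Iic_le_sum_norm (p : ℕ → ℂ) {n : ℕ} (hp : p n = p 0) :
    hullPerimeter (p '' Iic n) ≤ ∑ i ∈ Finset.range n, ‖p (i + 1) - p i‖ := by
  have hcont : ∀ i, Continuous fun θ => |proj θ (p (i + 1) - p i)| :=
    fun i => (continuous_proj_left _).abs
  have hsum : Continuous fun θ => ∑ i ∈ Finset.range n, |proj θ (p (i + 1) - p i)| / 2 :=
    continuous_finsetSum _ fun i _ => (hcont i).div_const 2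
  have hne : (p '' Iic n).Nonempty := ⟨p 0, 0, Nat.zero_le n, rfl⟩
  have hwidth : ∀ θ, width (p '' Iic n) θ ≤
      ∑ i ∈ Finset.range n, |proj θ (p (i + 1) - p i)| / 2 := fun θ => by
    refine width_le hne ?_
    rintro _ ⟨i, hi, rfl⟩ _ ⟨j, hj, rfl⟩
    have := two_mul_abs_sub_le_sum_abs_sub (fun i => proj θ (p i)) (congrArg _ hp) hj hi
    simp only [← map_sub] at this ⊢
    rw [← Finset.sum_div]
    linarith [le_abs_self (proj θ (p i - p j))]
  have := two_mul_hullPerimeter_le_integral ((finite_Iic n).image p).isBounded hne hsum hwidth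
  rw [intervalIntegral.integral_finsetSum
    fun i _ => ((hcont i).div_const 2).intervalIntegrable _ _] at this
  simp only [intervalIntegral.integral_div, integral_abs_proj, ← Finset.sum_div,
    ← Finset.mul_sum] at this
  linarith

lemma hullPerimeter_le_of_subset_thickening {A B : Set ℂ} (hB : IsBounded B) {ε : ℝ} (hε : 0 ≤ ε)
    (h : A ⊆ thickening ε B) : hullPerimeter A ≤ hullPerimeter B + 2 * π * ε := by
  rcases A.eq_empty_or_nonempty with rfl | hA
  · rw [hullPerimeter_empty]
    linarith [hullPerimeter_nonneg hB, show 0 ≤ 2 * π * ε by positivity]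
  have hne : B.Nonempty := thickening_nonempty_iff.1 (hA.mono h) |>.2
  have hcont := continuous_supportFunction hB hne
  have hsupp : ∀ θ, supportFunction A θ ≤ supportFunction B θ + ε := fun θ =>
    supportFunction_le hA fun z hz => by
      obtain ⟨w, hw, hzw⟩ := mem_thickening_iff.1 (h hz)
      have := proj_le θ (z - w)
      rw [map_sub, ← dist_eq_norm] at this
      linarith [proj_le_supportFunction hB θ hw]
  calc hullPerimeter A ≤ ∫ θ in (0)..(2 * π), (supportFunction B θ + ε) :=
        intervalIntegral.integral_mono (by positivity)
          ((continuous_supportFunction (hB.thickening.subset h) hA).intervalIntegrable _ _)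
          ((hcont.add continuous_const).intervalIntegrable _ _) hsupp
    _ = hullPerimeter B + 2 * π * ε := by
        rw [intervalIntegral.integral_add (hcont.intervalIntegrable _ _) intervalIntegrable_const,
          intervalIntegral.integral_const, smul_eq_mul, sub_zero, hullPerimeter]

lemma exists_range_subset_thickening_image_div {E : Type*} [PseudoMetricSpace E] {γ : ℝ → E}
    (hc : Continuous γ) (hp : Function.Periodic γ 1) {ε : ℝ} (hε : 0 < ε) :
    ∃ n : ℕ, n ≠ 0 ∧ range γ ⊆ thickening ε ((fun i : ℕ => γ (i / n)) '' Iic n) := by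
  obtain ⟨δ, hδ, hγ⟩ := uniformContinuousOn_iff.1
    (isCompact_Icc.uniformContinuousOn_of_continuous (hc.continuousOn (s := Icc (0 : ℝ) 1))) ε hε
  obtain ⟨m, hm⟩ := exists_nat_one_div_lt hδ
  have hn : (0 : ℝ) < (m + 1 : ℕ) := by positivity
  refine ⟨m + 1, m.succ_ne_zero, ?_⟩
  rw [← hp.image_Icc one_pos 0, zero_add]
  rintro _ ⟨t, ht, rfl⟩
  set i := ⌊t * (m + 1 : ℕ)⌋₊
  have hi : i ≤ t * (m + 1 : ℕ) := Nat.floor_le (by have := ht.1; positivity)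
  have hi' : t * (m + 1 : ℕ) < i + 1 := Nat.lt_floor_add_one _
  have hin : i ≤ m + 1 := Nat.cast_le.1 (hi.trans (mul_le_of_le_one_left hn.le ht.2))
  have hit : i / (m + 1 : ℕ) ≤ t := (div_le_iff₀ hn).2 hi
  refine mem_thickening_iff.2 ⟨_, mem_image_of_mem _ hin, hγ t ht _ ⟨by positivity, ?_⟩ ?_⟩
  · exact hit.trans ht.2
  · rw [Real.dist_eq, abs_of_nonneg (sub_nonneg.2 hit), sub_lt_iff_lt_add]
    refine ((lt_div_iff₀ hn).2 hi').trans ?_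
    rw [add_div, add_comm]
    gcongr
    exact_mod_cast hm

lemma sum_edist_div_le_curveLength (γ : ℝ → ℂ) (n : ℕ) :
    ∑ i ∈ Finset.range n, edist (γ ((i + 1 : ℕ) / n)) (γ (i / n)) ≤ curveLength γ := by
  have hmono : Monotone fun i : ℕ => (i / n : ℝ) := fun i j hij => by dsimp only; gcongr
  rw [Finset.range_eq_Ico]
  exact eVariationOn.sum_le_of_monotoneOn_Icc (hmono.monotoneOn _) fun i hi =>
    ⟨by positivity, div_le_one_of_le₀ (Nat.cast_le.2 hi.2) n.cast_nonneg⟩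

lemma hullPerimeter_range_le_curveLength {γ : ℝ → ℂ} (hc : Continuous γ)
    (hp : Function.Periodic γ 1) :
    ENNReal.ofReal (hullPerimeter (range γ)) ≤ curveLength γ := by
  refine ENNReal.le_of_forall_pos_le_add fun ε hε _ => ?_
  obtain ⟨n, hn, hγ⟩ := exists_range_subset_thickening_image_div hc hp
    (ε := ε / (2 * π)) (by positivity)
  have hclosed : γ ((n : ℕ) / n) = γ ((0 : ℕ) / n) := by
    rw [div_self (by exact_mod_cast hn), Nat.cast_zero, zero_div, hp.eq]
  calc ENNReal.ofReal (hullPerimeter (range γ))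
      ≤ ENNReal.ofReal (∑ i ∈ Finset.range n, ‖γ ((i + 1 : ℕ) / n) - γ (i / n)‖ + ε) := by
        refine ENNReal.ofReal_le_ofReal ((hullPerimeter_le_of_subset_thickening
          ((finite_Iic n).image _).isBounded (by positivity) hγ).trans ?_)
        rw [mul_div_cancel₀ _ (by positivity)]
        gcongr
        exact hullPerimeter_image_Iic_le_sum_norm _ hclosed
    _ = ∑ i ∈ Finset.range n, edist (γ ((i + 1 : ℕ) / n)) (γ (i / n)) + ε := by
        rw [ENNReal.ofReal_add (by positivity) ε.coe_nonneg,
          ENNReal.ofReal_sum_of_nonneg fun _ _ => norm_nonneg _, ENNReal.ofReal_coe_nnreal]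
        simp only [edist_dist, dist_eq_norm]
    _ ≤ curveLength γ + ε := by gcongr; exact sum_edist_div_le_curveLength γ n

end Curves

section Separation

section TopologicalSpace

variable {X : Type*} [TopologicalSpace X]

lemma isPreconnected_sdiff_of_isPreconnected_nhds_sdiff {O N S : Set X} (hO : IsOpen O)
    (hO' : IsPreconnected O) (hN : IsOpen N) (hNO : N ⊆ O) (hS : IsClosed S) (hSN : S ⊆ N)
    (hNS : IsPreconnected (N \ S)) : IsPreconnected (O \ S) := by
  rw [isPreconnected_iff_subset_of_disjoint]
  intro u v hu hv huv hdisj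
  have hNuv := isPreconnected_iff_subset_of_disjoint.1 hNS u v hu hv
    ((sdiff_subset_sdiff_left hNO).trans huv)
    (subset_empty_iff.1 (hdisj ▸ inter_subset_inter_left _ (sdiff_subset_sdiff_left hNO)))
  wlog hNu : N \ S ⊆ u generalizing u v
  · exact (this v u hv hu (union_comm u v ▸ huv) (inter_comm u v ▸ hdisj) hNuv.symm
      (hNuv.resolve_left hNu)).symm
  have hOSv : ∀ x ∈ v ∩ (O \ S), x ∉ N ∪ u := fun x ⟨hxv, hxO⟩ hx =>
    (eq_empty_iff_forall_notMem.1 hdisj x)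
      ⟨hxO, hx.elim (fun hxN => hNu ⟨hxN, hxO.2⟩) id, hxv⟩
  have hcover : O ⊆ (N ∪ u) ∪ (v ∩ (O \ S)) := fun x hx => by
    by_cases hxS : x ∈ S
    · exact .inl (.inl (hSN hxS))
    · exact (huv ⟨hx, hxS⟩).imp .inr fun hxv => ⟨hxv, hx, hxS⟩
  rcases hO'.subset_or_subset (hN.union hu) (hv.inter (hO.sdiff hS))
    (disjoint_left.2 fun x hx hxv => hOSv x hxv hx) hcover with h | h
  · exact .inl fun x hx => (h hx.1).elim (fun hxN => hNu ⟨hxN, hx.2⟩) id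
  · exact .inr fun x hx => (h hx.1).1

lemma exists_subset_of_isPreconnected_of_pairwiseDisjoint {ι : Type*} {t : Set X}
    (ht : IsPreconnected t) (hne : t.Nonempty) {s : Finset ι} {C : ι → Set X}
    (hC : ∀ i ∈ s, IsClosed (C i)) (hd : (s : Set ι).PairwiseDisjoint C)
    (hcov : t ⊆ ⋃ i ∈ s, C i) : ∃ i ∈ s, t ⊆ C i := by
  classical
  obtain ⟨x, hx⟩ := hne
  obtain ⟨i, hi, hxi⟩ := mem_iUnion₂.1 (hcov hx)
  refine ⟨i, hi, ?_⟩
  have hrest : IsClosed (⋃ j ∈ s.erase i, C j) :=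
    isClosed_biUnion_finset fun j hj => hC j (Finset.mem_of_mem_erase hj)
  have hdisj : Disjoint (C i) (⋃ j ∈ s.erase i, C j) := disjoint_iUnion₂_right.2 fun j hj =>
    hd hi (Finset.mem_of_mem_erase hj) (Finset.ne_of_mem_erase hj).symm
  rw [← Finset.insert_erase hi, Finset.set_biUnion_insert] at hcov
  refine (isPreconnected_iff_subset_of_disjoint_closed.1 ht _ _ (hC i hi) hrest hcov
    (by rw [hdisj.inter_eq, inter_empty])).resolve_right fun h => ?_
  exact disjoint_left.1 hdisj hxi (h hx)

end TopologicalSpace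

section NormedSpace

variable {E : Type*} [NormedAddCommGroup E] [NormedSpace ℝ E]

lemma isPreconnected_ball_sdiff_closedBall (hE : 1 < Module.rank ℝ E) {a : ℝ} (ha : 0 ≤ a)
    (b : ℝ) : IsPreconnected (ball (0 : E) b \ closedBall 0 a) := by
  have himage : ball (0 : E) b \ closedBall 0 a =
      (fun p : ℝ × E => p.1 • p.2) '' (Ioo a b ×ˢ sphere 0 1) := by
    ext z
    simp only [mem_sdiff, mem_ball_zero_iff, mem_closedBall_zero_iff, not_le, mem_image, mem_prod,
      mem_Ioo, mem_sphere_zero_iff_norm, Prod.exists]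
    constructor
    · rintro ⟨hzb, haz⟩
      have hz : ‖z‖ ≠ 0 := (ha.trans_lt haz).ne'
      refine ⟨‖z‖, ‖z‖⁻¹ • z, ⟨⟨haz, hzb⟩, ?_⟩, smul_inv_smul₀ hz z⟩
      rw [norm_smul, norm_inv, norm_norm, inv_mul_cancel₀ hz]
    · rintro ⟨x, y, ⟨⟨hax, hxb⟩, hy⟩, rfl⟩
      rw [norm_smul, hy, mul_one, Real.norm_of_nonneg (ha.trans hax.le)]
      exact ⟨hxb, hax⟩
  rw [himage]
  exact (isPreconnected_Ioo.prod (isPreconnected_sphere hE 0 1)).image _ (by fun_prop)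

lemma subset_of_frontier_subset_of_isPreconnected_compl [Nontrivial E] {V C : Set E}
    (hV : IsOpen V) (hVb : IsBounded V) (hCb : IsBounded C) (hC : IsPreconnected Cᶜ)
    (hVC : frontier V ⊆ C) : V ⊆ C := by
  by_contra h
  obtain ⟨x, hxV, hxC⟩ := not_subset.1 h
  have hCV : Cᶜ ⊆ V := by
    refine (hC.subset_or_subset hV isClosed_closure.isOpen_compl
      (disjoint_compl_right_iff_subset.2 subset_closure) fun z hz => ?_).resolve_right
        fun h => h hxC (subset_closure hxV)
    by_contra! hzV
    rw [mem_union, not_or, notMem_compl_iff] at hzV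
    exact hz (hVC (hV.frontier_eq ▸ ⟨hzV.2, hzV.1⟩))
  refine NormedSpace.unbounded_univ ℝ E ((hVb.union hCb).subset fun z _ => ?_)
  exact (em (z ∈ C)).symm.imp (@hCV z) id

variable [ProperSpace E]

/-- A convex body is a closed unit ball up to a homeomorphism of the space, and a ball has annular
neighbourhoods. -/
lemma isPreconnected_sdiff_of_convex_of_interior_nonempty (hE : 1 < Module.rank ℝ E)
    {O S : Set E} (hO : IsOpen O) (hO' : IsPreconnected O) (hS : IsCompact S) (hconv : Convex ℝ S)
    (hint : (interior S).Nonempty) (hSO : S ⊆ O) : IsPreconnected (O \ S) := by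
  obtain ⟨e, -, he, -⟩ :=
    exists_homeomorph_image_interior_closure_frontier_eq_unitBall hconv hint hS.isBounded
  rw [hS.isClosed.closure_eq] at he
  obtain ⟨η, hη, hsub⟩ := (isCompact_closedBall (0 : E) 1).exists_thickening_subset_open
    (e.isOpenMap _ hO) (he ▸ image_mono hSO)
  rw [thickening_closedBall hη zero_le_one] at hsub
  have hSe : S = e ⁻¹' closedBall 0 1 := by rw [← he, preimage_image_eq _ e.injective]
  refine isPreconnected_sdiff_of_isPreconnected_nhds_sdiff (N := e ⁻¹' ball 0 (η + 1)) hO hO'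
    (isOpen_ball.preimage e.continuous) ?_ hS.isClosed ?_ ?_
  · rw [← preimage_image_eq O e.injective]
    exact preimage_mono hsub
  · rw [hSe]
    exact preimage_mono (closedBall_subset_ball (by linarith))
  · rw [hSe, ← preimage_sdiff, ← e.image_symm]
    exact (isPreconnected_ball_sdiff_closedBall hE zero_le_one _).image _
      e.symm.continuous.continuousOn

lemma isPreconnected_sdiff_of_convex (hE : 1 < Module.rank ℝ E) {O D : Set E} (hO : IsOpen O)
    (hO' : IsPreconnected O) (hD : IsCompact D) (hconv : Convex ℝ D) (hDO : D ⊆ O) :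
    IsPreconnected (O \ D) := by
  rcases D.eq_empty_or_nonempty with rfl | hne
  · rwa [sdiff_empty]
  obtain ⟨δ₀, hδ₀, hδO⟩ := hD.exists_cthickening_subset_open hO hDO
  refine isPreconnected_of_forall_pair fun x hx y hy => ?_
  have hpos : ∀ z ∈ O \ D, 0 < infDist z D := fun z hz =>
    (hD.isClosed.notMem_iff_infDist_pos hne).1 hz.2
  obtain ⟨δ, hδ, hδmin⟩ := exists_between (lt_min hδ₀ (lt_min (hpos x hx) (hpos y hy)))
  obtain ⟨hδδ₀, hδx, hδy⟩ : δ < δ₀ ∧ δ < infDist x D ∧ δ < infDist y D := by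
    simpa only [lt_min_iff] using hδmin
  have hmem : ∀ z ∈ O, δ < infDist z D → z ∈ O \ cthickening δ D := fun z hz hzδ =>
    ⟨hz, fun h => hzδ.not_ge (ENNReal.toReal_le_of_le_ofReal hδ.le (mem_cthickening_iff.1 h))⟩
  refine ⟨O \ cthickening δ D, sdiff_subset_sdiff_right (self_subset_cthickening D),
    hmem x hx.1 hδx, hmem y hy.1 hδy, ?_⟩
  refine isPreconnected_sdiff_of_convex_of_interior_nonempty hE hO hO' hD.cthickening
    (hconv.cthickening δ) ?_ ((cthickening_mono hδδ₀.le D).trans hδO)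
  exact (hne.mono (self_subset_thickening hδ D)).mono
    (interior_maximal (thickening_subset_cthickening δ D) isOpen_thickening)

lemma isPreconnected_compl_sUnion_of_convex (hE : 1 < Module.rank ℝ E) (s : Finset (Set E))
    (hs : ∀ D ∈ s, IsCompact D ∧ Convex ℝ D) (hd : (s : Set (Set E)).PairwiseDisjoint id) :
    IsPreconnected (⋃₀ (s : Set (Set E)))ᶜ := by
  classical
  induction s using Finset.induction_on with
  | empty => simpa using isPreconnected_univ
  | insert D s hDs ih =>
    rw [Finset.forall_mem_insert] at hs
    rw [Finset.coe_insert] at hd ⊢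
    rw [sUnion_insert, union_comm, compl_union, ← sdiff_eq]
    refine isPreconnected_sdiff_of_convex hE ?_ (ih hs.2 (hd.subset (subset_insert _ _))) hs.1.1
      hs.1.2 ?_
    · exact (s.finite_toSet.isCompact_sUnion fun C hC => (hs.2 C hC).1).isClosed.isOpen_compl
    · rw [subset_compl_iff_disjoint_right, disjoint_sUnion_right]
      exact fun C hC => hd (mem_insert _ _) (mem_insert_of_mem _ hC)
        (ne_of_mem_of_not_mem hC hDs).symm

end NormedSpace

end Separation

section Merging

lemma exists_pairwiseDisjoint_of_merge {α : Type*} {P : Set α → Prop} {w : Set α → ℝ}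
    (hw : ∀ D, P D → 0 ≤ w D)
    (hmerge : ∀ C D, P C → P D → (C ∩ D).Nonempty → ∃ E, P E ∧ C ∪ D ⊆ E ∧ w E ≤ w C + w D)
    (s : Finset (Set α)) (hs : ∀ D ∈ s, P D) :
    ∃ t : Finset (Set α), (∀ D ∈ t, P D) ∧ (t : Set (Set α)).PairwiseDisjoint id ∧
      ⋃₀ (s : Set (Set α)) ⊆ ⋃₀ (t : Set (Set α)) ∧ ∑ D ∈ t, w D ≤ ∑ D ∈ s, w D := by
  classical
  induction hcard : s.card using Nat.strong_induction_on generalizing s with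
  | _ n ih =>
    by_cases hd : (s : Set (Set α)).PairwiseDisjoint id
    · exact ⟨s, hs, hd, Subset.rfl, le_rfl⟩
    obtain ⟨C, hC, D, hD, hCD, hne⟩ : ∃ C ∈ s, ∃ D ∈ s, C ≠ D ∧ (C ∩ D).Nonempty := by
      simpa [Set.PairwiseDisjoint, Set.Pairwise, not_disjoint_iff_nonempty_inter] using hd
    obtain ⟨E, hE, hCDE, hwE⟩ := hmerge C D (hs C hC) (hs D hD) hne
    set r := (s.erase C).erase D
    have hsr : s = insert C (insert D r) := by
      rw [Finset.insert_erase (Finset.mem_erase.2 ⟨hCD.symm, hD⟩), Finset.insert_erase hC]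
    have hDr : D ∉ r := Finset.notMem_erase _ _
    have hCr : C ∉ insert D r := by simp [r, hCD]
    have hlt : (insert E r).card < n := by
      rw [← hcard, hsr, Finset.card_insert_of_notMem hCr, Finset.card_insert_of_notMem hDr]
      exact (Finset.card_insert_le E r).trans_lt (by omega)
    obtain ⟨t, ht, htd, hst, hwt⟩ := ih (insert E r).card hlt (insert E r)
      (Finset.forall_mem_insert .. |>.2 ⟨hE, fun F hF => hs F (by simp [hsr, hF])⟩) rfl
    refine ⟨t, ht, htd, Subset.trans ?_ hst, hwt.trans ?_⟩
    · rw [hsr]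
      simp only [Finset.coe_insert, sUnion_insert, ← union_assoc]
      exact union_subset_union_left _ hCDE
    · calc ∑ F ∈ insert E r, w F ≤ w E + ∑ F ∈ r, w F := by
            by_cases hEr : E ∈ r
            · rw [Finset.insert_eq_of_mem hEr]
              linarith [hw E hE]
            · rw [Finset.sum_insert hEr]
        _ ≤ w C + (w D + ∑ F ∈ r, w F) := by linarith
        _ = ∑ F ∈ s, w F := by rw [hsr, Finset.sum_insert hCr, Finset.sum_insert hDr]

lemma isCompact_closedConvexHull {E : Type*} [NormedAddCommGroup E] [NormedSpace ℝ E]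
    [ProperSpace E] {A : Set E} (hA : IsBounded A) : IsCompact (closedConvexHull ℝ A) := by
  rw [closedConvexHull_eq_closure_convexHull]
  exact (isBounded_convexHull.2 hA).isCompact_closure

lemma exists_pairwiseDisjoint_convex_cover {ι κ : Type*} [Fintype ι] {G : ι → Set ℂ}
    (hG : ∀ i, IsBounded (G i)) {I : Set κ} {W : κ → Set ℂ} (hW : ∀ a ∈ I, IsClosed (W a))
    (hWconv : ∀ a ∈ I, Convex ℝ (W a)) (hWd : I.PairwiseDisjoint W)
    (hGW : ∀ i, ∃ a ∈ I, G i ⊆ W a) :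
    ∃ s : Finset (Set ℂ), (∀ D ∈ s, IsCompact D ∧ Convex ℝ D ∧ ∃ a ∈ I, D ⊆ W a) ∧
      (s : Set (Set ℂ)).PairwiseDisjoint id ∧ (∀ i, G i ⊆ ⋃₀ (s : Set (Set ℂ))) ∧
      ∑ D ∈ s, hullPerimeter D ≤ ∑ i, hullPerimeter (G i) := by
  classical
  let P : Set ℂ → Prop := fun D => IsCompact D ∧ Convex ℝ D ∧ ∃ a ∈ I, D ⊆ W a
  have hhull : ∀ A : Set ℂ, IsBounded A → (∃ a ∈ I, A ⊆ W a) → P (closedConvexHull ℝ A) :=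
    fun A hA ⟨a, ha, hAa⟩ => ⟨isCompact_closedConvexHull hA, convex_closedConvexHull, a, ha,
      closedConvexHull_min hAa (hWconv a ha) (hW a ha)⟩
  have himage : ∀ D ∈ Finset.univ.image fun i => (closedConvexHull ℝ (G i) : Set ℂ), P D := by
    simpa only [Finset.forall_mem_image, Finset.mem_univ, true_imp_iff] using
      fun i => hhull _ (hG i) (hGW i)
  have hmerge : ∀ C D : Set ℂ, P C → P D → (C ∩ D).Nonempty →
      ∃ F, P F ∧ C ∪ D ⊆ F ∧ hullPerimeter F ≤ hullPerimeter C + hullPerimeter D := by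
    rintro C D ⟨hC, -, a, ha, hCa⟩ ⟨hD, -, b, hb, hDb⟩ hne
    obtain rfl : a = b := hWd.elim ha hb
      (not_disjoint_iff_nonempty_inter.2 (hne.mono (inter_subset_inter hCa hDb)))
    have hCD := hC.isBounded.union hD.isBounded
    refine ⟨_, hhull (C ∪ D) hCD ⟨a, ha, union_subset hCa hDb⟩, subset_closedConvexHull, ?_⟩
    rw [hullPerimeter_closedConvexHull hCD]
    exact hullPerimeter_union_le hC.isBounded hD.isBounded hne
  obtain ⟨s, hs, hsd, hcov, hsum⟩ := exists_pairwiseDisjoint_of_merge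
    (fun D hD => hullPerimeter_nonneg hD.1.isBounded) hmerge _ himage
  refine ⟨s, hs, hsd, fun i => ?_, hsum.trans ?_⟩
  · have hmem := Finset.mem_image_of_mem (fun i => (closedConvexHull ℝ (G i) : Set ℂ))
      (Finset.mem_univ i)
    exact subset_closedConvexHull.trans ((subset_sUnion_of_mem (Finset.mem_coe.2 hmem)).trans hcov)
  · refine (Finset.sum_image_le_of_nonneg fun D hD =>
      hullPerimeter_nonneg (himage D hD).1.isBounded).trans_eq ?_
    exact Finset.sum_congr rfl fun i _ => hullPerimeter_closedConvexHull (hG i)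

end Merging

section Polygon

/-- The `j`-th vertex of the regular `N`-gon with centre `c` and circumradius `r`; the vertices
are listed once by `1 ≤ j ≤ N`. -/
noncomputable def polygonVertex (c : ℂ) (r : ℝ) (N j : ℕ) : ℂ := circleMap c r (2 * π * j / N)

lemma dist_circleMap (c : ℂ) {r : ℝ} (hr : 0 ≤ r) (α β : ℝ) :
    dist (circleMap c r α) (circleMap c r β) = 2 * r * |Real.sin ((α - β) / 2)| := by
  have hfactor : circleMap c r α - circleMap c r β =
      r * Complex.exp (β * Complex.I) * (Complex.exp (Complex.I * ((α - β : ℝ) : ℂ)) - 1) := by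
    rw [circleMap, circleMap, add_sub_add_left_eq_sub, ← mul_sub, mul_assoc, mul_sub _ _ (1 : ℂ),
      ← Complex.exp_add, mul_one]
    congr 3
    push_cast
    ring
  rw [dist_eq_norm, hfactor, norm_mul, norm_mul, Complex.norm_exp_ofReal_mul_I,
    Complex.norm_exp_I_mul_ofReal_sub_one, Complex.norm_real, Real.norm_of_nonneg hr, norm_mul,
    Real.norm_two, Real.norm_eq_abs]
  ring

lemma dist_polygonVertex (c : ℂ) {r : ℝ} (hr : 0 ≤ r) {N a b T : ℕ} (hT : 2 * T ≤ N)
    (h : a = b + T ∨ a + T = b + N) :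
    dist (polygonVertex c r N a) (polygonVertex c r N b) = 2 * r * Real.sin (π * T / N) := by
  rcases N.eq_zero_or_pos with rfl | hN
  · simp [polygonVertex]
  have hN' : (0 : ℝ) < N := Nat.cast_pos.2 hN
  have hT' : 2 * (T : ℝ) ≤ N := mod_cast hT
  have hsin : 0 ≤ Real.sin (π * T / N) := by
    refine Real.sin_nonneg_of_nonneg_of_le_pi (by positivity) ?_
    rw [div_le_iff₀ hN']
    exact mul_le_mul_of_nonneg_left (by linarith [T.cast_nonneg (α := ℝ)]) Real.pi_pos.le
  rw [polygonVertex, polygonVertex, dist_circleMap c hr]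
  congr 1
  rcases h with rfl | h
  · rw [← abs_of_nonneg hsin]
    congr 2
    push_cast
    ring
  · rw [← abs_of_nonneg hsin, ← Real.sin_pi_sub]
    have hab : (a : ℝ) = b + N - T := eq_sub_of_add_eq (mod_cast h)
    congr 2
    rw [hab]
    field

lemma mul_div_le_dist_polygonVertex (c : ℂ) {r : ℝ} (hr : 0 ≤ r) {N a b T : ℕ} (hT : 2 * T ≤ N)
    (h : a = b + T ∨ a + T = b + N) :
    4 * r * T / N ≤ dist (polygonVertex c r N a) (polygonVertex c r N b) := by
  have hT' : (T : ℝ) / N ≤ 1 / 2 := by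
    refine div_le_of_le_mul₀ (by positivity) (by positivity) ?_
    have : 2 * (T : ℝ) ≤ N := mod_cast hT
    linarith
  have hsin : 2 / π * (π * (T / N)) ≤ Real.sin (π * (T / N)) :=
    Real.mul_le_sin (by positivity) (by linarith [mul_le_mul_of_nonneg_left hT' Real.pi_pos.le])
  rw [dist_polygonVertex c hr hT h, mul_div_assoc π]
  calc 4 * r * T / N = 2 * r * (2 / π * (π * (T / N))) := by field
    _ ≤ _ := by gcongr

lemma div_le_dist_polygonVertex (c : ℂ) {r : ℝ} (hr : 0 ≤ r) {N i j : ℕ}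
    (hi : i ∈ Finset.Icc 1 N) (hj : j ∈ Finset.Icc 1 N) (hij : i ≠ j) :
    4 * r / N ≤ dist (polygonVertex c r N i) (polygonVertex c r N j) := by
  wlog hlt : j < i generalizing i j
  · rw [dist_comm]
    exact this hj hi hij.symm (by omega)
  rw [Finset.mem_Icc] at hi hj
  obtain ⟨T, hT, hTN, h⟩ : ∃ T, 1 ≤ T ∧ 2 * T ≤ N ∧ (i = j + T ∨ i + T = j + N) := by
    rcases le_total (2 * (i - j)) N with h | h
    · exact ⟨i - j, by omega, h, by omega⟩
    · exact ⟨j + N - i, by omega, by omega, by omega⟩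
  refine le_trans ?_ (mul_div_le_dist_polygonVertex c hr hTN h)
  have hT' : (1 : ℝ) ≤ T := mod_cast hT
  exact div_le_div_of_nonneg_right (le_mul_of_one_le_right (by positivity) hT') N.cast_nonneg

/-- If no two elements are at cyclic distance at least `N / 3`, then all of them lie in an arc of
length less than `N / 3`. -/
lemma exists_cyclic_gap {N : ℕ} {J : Finset ℕ} (hJ : J ⊆ Finset.Icc 1 N) (hne : J.Nonempty) :
    ∃ a ∈ J, ∃ b ∈ J, ∃ T, (a = b + T ∨ a + T = b + N) ∧ 2 * T ≤ N ∧
      (N ≤ 3 * T ∨ J.card ≤ T + 1) := by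
  by_cases! hmid : ∃ a ∈ J, ∃ b ∈ J, N + 3 * b ≤ 3 * a ∧ 3 * a ≤ 2 * N + 3 * b
  · obtain ⟨a, ha, b, hb, h⟩ := hmid
    rcases le_total (2 * (a - b)) N with h' | h'
    · exact ⟨a, ha, b, hb, a - b, by omega⟩
    · exact ⟨a, ha, b, hb, N + b - a, by omega⟩
  have hmem : ∀ x ∈ J, 1 ≤ x ∧ x ≤ N := fun x hx => Finset.mem_Icc.1 (hJ hx)
  obtain ⟨m, hm, hmin⟩ := J.exists_min_image id hne
  obtain ⟨q, hq, hqmax⟩ := (J.filter fun x => 3 * x < N + 3 * m).exists_max_image id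
    ⟨m, Finset.mem_filter.2 ⟨hm, by have := hmem m hm; omega⟩⟩
  simp only [Finset.mem_filter, id_eq, and_imp] at hq hqmax hmin
  rcases (J.filter fun x => ¬ 3 * x < N + 3 * m).eq_empty_or_nonempty with hfar | hfar
  · have hsub : J ⊆ Finset.Icc m q := fun x hx => Finset.mem_Icc.2
      ⟨hmin x hx, hqmax x hx (not_not.1 (Finset.filter_eq_empty_iff.1 hfar hx))⟩
    have hcard := Finset.card_le_card hsub
    rw [Nat.card_Icc] at hcard
    exact ⟨q, hq.1, m, hm, q - m, by have := hmin q hq.1; omega⟩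
  · obtain ⟨p, hp, hpmin⟩ := Finset.exists_min_image _ id hfar
    simp only [Finset.mem_filter, id_eq, and_imp] at hp hpmin
    have hsub : J ⊆ Finset.Icc m q ∪ Finset.Icc p N := fun x hx => by
      rw [Finset.mem_union, Finset.mem_Icc, Finset.mem_Icc]
      exact (em (3 * x < N + 3 * m)).imp (fun h => ⟨hmin x hx, hqmax x hx h⟩)
        fun h => ⟨hpmin x hx h, (hmem x hx).2⟩
    have hcard := (Finset.card_le_card hsub).trans (Finset.card_union_le _ _)
    rw [Nat.card_Icc, Nat.card_Icc] at hcard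
    have hpm := hmid p hp.1 m hm
    have hpq := hmid p hp.1 q hq.1
    have hmq := hmin q hq.1
    have hmN := hmem m hm
    have hpN := hmem p hp.1
    exact ⟨p, hp.1, q, hq.1, N + q - p, by omega⟩

lemma exists_far_polygonVertex_pair (c : ℂ) {r : ℝ} (hr : 0 ≤ r) {N : ℕ} {J : Finset ℕ}
    (hJ : J ⊆ Finset.Icc 1 N) (hne : J.Nonempty) (hcard : 2 * J.card ≤ N) :
    ∃ a ∈ J, ∃ b ∈ J, 2 * √3 * r * (J.card - 1) / N ≤
      dist (polygonVertex c r N a) (polygonVertex c r N b) := by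
  obtain ⟨a, ha, b, hb, T, hab, hTN, hT⟩ := exists_cyclic_gap hJ hne
  refine ⟨a, ha, b, hb, ?_⟩
  have hJ0 : 0 < J.card := hne.card_pos
  have hN : (0 : ℝ) < N := Nat.cast_pos.2 (by omega)
  rcases hT with hT | hT
  · have hTN' : 2 * (T : ℝ) ≤ N := mod_cast hTN
    have hT' : (N : ℝ) ≤ 3 * T := mod_cast hT
    have hJN : ((J.card : ℝ) - 1) / N ≤ 1 / 2 := by
      rw [div_le_div_iff₀ hN two_pos]
      have : 2 * (J.card : ℝ) ≤ N := mod_cast hcard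
      linarith
    have hsin : √3 / 2 ≤ Real.sin (π * T / N) := by
      rw [← Real.sin_pi_div_three]
      refine Real.sin_le_sin_of_le_of_le_pi_div_two (by linarith [Real.pi_pos]) ?_ ?_
      · rw [div_le_div_iff₀ hN two_pos]
        nlinarith [Real.pi_pos]
      · rw [div_le_div_iff₀ three_pos hN]
        nlinarith [Real.pi_pos]
    rw [dist_polygonVertex c hr hTN hab]
    calc 2 * √3 * r * (J.card - 1) / N = 2 * √3 * r * ((J.card - 1) / N) := by ring
      _ ≤ 2 * √3 * r * (1 / 2) := by gcongr
      _ = 2 * r * (√3 / 2) := by ring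
      _ ≤ _ := by gcongr
  · refine le_trans ?_ (mul_div_le_dist_polygonVertex c hr hTN hab)
    have hsqrt : √3 ≤ 2 := Real.sqrt_le_iff.2 (by norm_num)
    have hT' : (J.card : ℝ) - 1 ≤ T := sub_le_iff_le_add.2 (mod_cast hT)
    have hJ1 : (0 : ℝ) ≤ J.card - 1 := sub_nonneg.2 (mod_cast hJ0)
    gcongr
    linarith

lemma exists_antipodal_pair {M : ℕ} {J : Finset ℕ} (hJ : J ⊆ Finset.Icc 1 (M + M))
    (hcard : M < J.card) : ∃ j ∈ J, j + M ∈ J := by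
  have hmem : ∀ x ∈ J, 1 ≤ x ∧ x ≤ M + M := fun x hx => Finset.mem_Icc.1 (hJ hx)
  have hmaps : MapsTo (fun x => if x ≤ M then x else x - M) J (Finset.Icc 1 M) := fun x hx => by
    have := hmem x hx
    rw [Finset.coe_Icc, mem_Icc]
    dsimp only
    split_ifs <;> omega
  obtain ⟨x, hx, y, hy, hxy, h⟩ :=
    Finset.exists_ne_map_eq_of_card_lt_of_maps_to (by simpa using hcard) hmaps
  split_ifs at h
  · exact absurd h hxy
  · exact ⟨x, hx, by rwa [show x + M = y by have := hmem y hy; omega]⟩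
  · exact ⟨y, hy, by rwa [show y + M = x by have := hmem x hx; omega]⟩
  · exact absurd h (by omega)

lemma card_mul_le_integral_of_arcs {g : ℝ → ℝ} (hg : Continuous g)
    (hper : Function.Periodic g (2 * π)) (hg0 : ∀ θ, 0 ≤ g θ) {N : ℕ} {J : Finset ℕ}
    (hJ : J ⊆ Finset.Icc 1 N) {w : ℝ}
    (hw : ∀ j ∈ J, ∀ θ, |θ - 2 * π * j / N| ≤ π / N → w ≤ g θ) :
    J.card * (2 * π / N * w) ≤ ∫ θ in 0..2 * π, g θ := by
  classical
  rcases N.eq_zero_or_pos with rfl | hN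
  · simpa using intervalIntegral.integral_nonneg Real.two_pi_pos.le fun θ _ => hg0 θ
  let a : ℕ → ℝ := fun j => 2 * π * j / N - π / N
  have ha : ∀ j, a (j + 1) - a j = 2 * π / N := fun j => by simp only [a]; push_cast; ring
  have hle : ∀ j, a j ≤ a (j + 1) := fun j => sub_nonneg.1 (ha j ▸ by positivity)
  have harc : ∀ j ∈ Finset.Ico 1 (N + 1), (if j ∈ J then 2 * π / N * w else 0) ≤
      ∫ θ in a j..a (j + 1), g θ := fun j _ => by
    split_ifs with hj
    · have hmono : ∫ _ in a j..a (j + 1), w ≤ ∫ θ in a j..a (j + 1), g θ := by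
        refine intervalIntegral.integral_mono_on (hle j) (by simp) (hg.intervalIntegrable _ _)
          fun θ hθ => hw j hj θ (abs_le.2 ⟨?_, ?_⟩)
        · linarith [hθ.1, show a j = 2 * π * j / N - π / N from rfl]
        · linarith [hθ.2, ha j, show a j = 2 * π * j / N - π / N from rfl,
            show 2 * π / N = 2 * (π / N) by ring]
      rwa [intervalIntegral.integral_const, ha, smul_eq_mul] at hmono
    · exact intervalIntegral.integral_nonneg (hle j) fun θ _ => hg0 θ
  calc J.card * (2 * π / N * w)
      = ∑ j ∈ Finset.Ico 1 (N + 1), if j ∈ J then 2 * π / N * w else 0 := by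
        rw [Finset.sum_ite_mem, Finset.inter_eq_right.2, Finset.sum_const, nsmul_eq_mul]
        exact hJ
    _ ≤ ∑ j ∈ Finset.Ico 1 (N + 1), ∫ θ in a j..a (j + 1), g θ := Finset.sum_le_sum harc
    _ = ∫ θ in a 1..a 1 + 2 * π, g θ := by
        rw [intervalIntegral.sum_integral_adjacent_intervals_Ico (by omega)
          fun _ _ => hg.intervalIntegrable _ _]
        congr 1
        simp only [a]
        push_cast
        field_simp
        ring
    _ = ∫ θ in 0..2 * π, g θ := by rw [hper.intervalIntegral_add_eq (a 1) 0, zero_add]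

lemma integral_supportFunction_sub_proj {A : Set ℂ} (hA : IsBounded A) (hne : A.Nonempty)
    (c : ℂ) : ∫ θ in 0..2 * π, (supportFunction A θ - proj θ c) = hullPerimeter A := by
  rw [intervalIntegral.integral_sub
    ((continuous_supportFunction hA hne).intervalIntegrable _ _)
    ((continuous_proj_left c).intervalIntegrable _ _), integral_proj, sub_zero, hullPerimeter]

lemma mul_cos_le_supportFunction_sub_proj_add {A : Set ℂ} (hA : IsBounded A) {c : ℂ} {r ρ φ : ℝ}
    (h : (A ∩ closedBall (circleMap c r φ) ρ).Nonempty) (θ : ℝ) :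
    r * Real.cos (θ - φ) ≤ supportFunction A θ - proj θ c + ρ := by
  obtain ⟨z, hzA, hz⟩ := h
  have hz' := (proj_le θ _).trans ((dist_eq_norm _ _).ge.trans (mem_closedBall'.1 hz))
  rw [map_sub, proj_circleMap] at hz'
  linarith [proj_le_supportFunction hA θ hzA]

lemma card_mul_le_hullPerimeter_of_polygon {A : Set ℂ} (hA : IsBounded A) {c : ℂ} {r ρ : ℝ}
    (hr : 0 ≤ r) {N : ℕ} (hN : Even N) {J : Finset ℕ} (hJ : J ⊆ Finset.Icc 1 N)
    (hcard : N < 2 * J.card)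
    (hmeet : ∀ j ∈ J, (A ∩ closedBall (polygonVertex c r N j) ρ).Nonempty) :
    J.card * (2 * π / N * (r * Real.cos (π / N))) ≤ hullPerimeter A + 2 * π * ρ := by
  obtain ⟨M, rfl⟩ := hN
  set N := M + M with hNM
  have hN : (0 : ℝ) < N := Nat.cast_pos.2 (by
    have := Finset.card_le_card hJ
    rw [Nat.card_Icc] at this
    omega)
  obtain ⟨j₀, hj₀, hj₁⟩ := exists_antipodal_pair hJ (by omega)
  have hne : A.Nonempty := (hmeet j₀ hj₀).mono inter_subset_left
  let g : ℝ → ℝ := fun θ => supportFunction A θ - proj θ c + ρ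
  have hg : ∀ j ∈ J, ∀ θ, r * Real.cos (θ - 2 * π * j / N) ≤ g θ := fun j hj =>
    mul_cos_le_supportFunction_sub_proj_add hA (hmeet j hj)
  have hg0 : ∀ θ, 0 ≤ g θ := fun θ => by
    have h₀ := hg j₀ hj₀ θ
    have h₁ := hg _ hj₁ θ
    have hangle : θ - 2 * π * (j₀ + M : ℕ) / N = θ - 2 * π * j₀ / N - π := by
      have : (N : ℝ) = 2 * M := by rw [hNM]; push_cast; ring
      have hM : (M : ℝ) ≠ 0 := by rintro h; rw [h] at this; linarith
      rw [this]
      push_cast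
      field
    rw [hangle, Real.cos_sub_pi] at h₁
    linarith
  have hdiff : Continuous fun θ => supportFunction A θ - proj θ c :=
    (continuous_supportFunction hA hne).sub (continuous_proj_left c)
  have hgc : Continuous g := hdiff.add continuous_const
  have hper : Function.Periodic g (2 * π) := fun θ => by
    simp only [g, supportFunction_periodic A θ, proj_periodic c θ]
  have hint : ∫ θ in 0..2 * π, g θ = hullPerimeter A + 2 * π * ρ := by
    rw [intervalIntegral.integral_add (hdiff.intervalIntegrable _ _) (by simp),
      integral_supportFunction_sub_proj hA hne, intervalIntegral.integral_const, sub_zero,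
      smul_eq_mul]
  rw [← hint]
  refine card_mul_le_integral_of_arcs hgc hper hg0 hJ fun j hj θ hθ => (hg j hj θ).trans' ?_
  have hN1 : (1 : ℝ) ≤ N := Nat.one_le_cast.2 (Nat.cast_pos.1 hN)
  rw [← Real.cos_abs (θ - _)]
  exact mul_le_mul_of_nonneg_left (Real.cos_le_cos_of_nonneg_of_le_pi (abs_nonneg _)
    (div_le_self Real.pi_pos.le hN1) hθ) hr

lemma one_sub_inv_le_cos_pi_div {x : ℝ} (hx : 5 ≤ x) : 1 - 1 / x ≤ Real.cos (π / x) := by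
  refine le_trans (sub_le_sub_left ?_ 1) Real.one_sub_sq_div_two_le_cos
  rw [div_pow, div_div, div_le_div_iff₀ (by positivity) (by positivity)]
  have hpi : π ^ 2 ≤ 10 := by nlinarith [Real.pi_lt_d2, Real.pi_pos]
  nlinarith

lemma mul_card_div_le_hullPerimeter_of_polygon {A : Set ℂ} (hA : IsBounded A) {c : ℂ} {r : ℝ}
    (hr : 0 ≤ r) {N : ℕ} (hN : Even N) (hN5 : 5 ≤ N) {J : Finset ℕ} (hJ : J ⊆ Finset.Icc 1 N)
    (hcard : N < 2 * J.card)
    (hmeet : ∀ j ∈ J,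
      (A ∩ closedBall (polygonVertex c (r * (1 - 1 / N)) N j) (r / N)).Nonempty) :
    2 * π * (1 - 4 / N) * (r * (J.card / N)) ≤ hullPerimeter A := by
  have hN5' : (5 : ℝ) ≤ N := mod_cast hN5
  have hx : 1 / (N : ℝ) ≤ 1 := div_le_one_of_le₀ (by linarith) N.cast_nonneg
  have hpolygon := card_mul_le_hullPerimeter_of_polygon hA
    (mul_nonneg hr (sub_nonneg.2 hx)) hN hJ hcard hmeet
  have hcos := one_sub_inv_le_cos_pi_div hN5'
  have hJN : 1 / 2 ≤ (J.card : ℝ) / N := by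
    rw [div_le_div_iff₀ two_pos (by linarith)]
    have : (N : ℝ) < 2 * J.card := mod_cast hcard
    linarith
  have hnum : (1 - 4 / N) * (J.card / N : ℝ) + 1 / N ≤
      J.card / N * ((1 - 1 / N) * (1 - 1 / N)) := by
    rw [show (4 : ℝ) / N = 4 * (1 / N) by ring]
    nlinarith [mul_nonneg (one_div_nonneg.2 N.cast_nonneg) (sub_nonneg.2 hJN),
      mul_nonneg (sq_nonneg (1 / (N : ℝ))) (div_nonneg J.card.cast_nonneg N.cast_nonneg)]
  have hle : (J.card : ℝ) / N * ((1 - 1 / N) * (1 - 1 / N)) ≤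
      J.card / N * ((1 - 1 / N) * Real.cos (π / N)) := by
    gcongr
  have hfinal := mul_le_mul_of_nonneg_left (hnum.trans hle) (mul_nonneg Real.two_pi_pos.le hr)
  linear_combination hfinal + hpolygon

end Polygon

section Construction

/-- The radius of the discs of level `n + 1`. The shift by one makes the recursion start at the
closed unit disc `K₁` and hold without exception. -/
noncomputable def radius : ℕ → ℝ
  | 0 => 1
  | n + 1 => radius n / 2 ^ (n + 2)

/-- The centre of the `j`-th disc of level `n + 2` in the disc of level `n + 1` with centre `c`,
for `1 ≤ j ≤ 2 ^ (n + 2)`. -/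
noncomputable def child (c : ℂ) (n j : ℕ) : ℂ :=
  polygonVertex c (radius n * (1 - 1 / (2 ^ (n + 2) : ℕ))) (2 ^ (n + 2)) j

/-- The centres of the discs of level `n + d + 1` in the disc of level `n + 1` with centre `c`. -/
noncomputable def descendants : ℂ → ℕ → ℕ → Finset ℂ
  | c, _, 0 => {c}
  | c, n, d + 1 =>
    (Finset.Icc 1 (2 ^ (n + 2))).biUnion fun j => descendants (child c n j) (n + 1) d

lemma radius_pos : ∀ n, 0 < radius n
  | 0 => one_pos
  | n + 1 => div_pos (radius_pos n) (by positivity)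

lemma radius_succ_le_half (n : ℕ) : radius (n + 1) ≤ radius n / 2 := by
  rw [radius]
  have hr := (radius_pos n).le
  gcongr
  exact le_self_pow₀ one_le_two (by omega)

lemma radius_le_half_pow (n : ℕ) : radius n ≤ (1 / 2) ^ n := by
  induction n with
  | zero => simp [radius]
  | succ n ih =>
    rw [pow_succ]
    linarith [radius_succ_le_half n]

lemma antitone_radius : Antitone radius :=
  antitone_nat_of_succ_le fun n => (radius_succ_le_half n).trans (half_le_self (radius_pos n).le)

lemma tendsto_radius : Filter.Tendsto radius Filter.atTop (nhds 0) :=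
  squeeze_zero (fun n => (radius_pos n).le) radius_le_half_pow
    (tendsto_pow_atTop_nhds_zero_of_lt_one (by norm_num) (by norm_num))

lemma dist_child (c : ℂ) (n j : ℕ) : dist (child c n j) c = radius n - radius (n + 1) := by
  have hle : (1 : ℝ) / (2 ^ (n + 2) : ℕ) ≤ 1 := by
    simpa using inv_le_one_of_one_le₀ (one_le_pow₀ one_le_two)
  rw [child, polygonVertex, dist_eq_norm, circleMap_sub_center, norm_circleMap_zero,
    abs_of_nonneg (mul_nonneg (radius_pos n).le (sub_nonneg.2 hle)), radius]
  push_cast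
  ring

lemma closedBall_child_subset (c : ℂ) (n j : ℕ) {l : ℝ} (hl : 1 ≤ l) :
    closedBall (child c n j) (l * radius (n + 1)) ⊆ closedBall c (l * radius n) := by
  apply closedBall_subset_closedBall'
  rw [dist_child]
  nlinarith [antitone_radius n.le_succ]

lemma three_mul_radius_le_dist_child (c : ℂ) (n : ℕ) {i j : ℕ}
    (hi : i ∈ Finset.Icc 1 (2 ^ (n + 2))) (hj : j ∈ Finset.Icc 1 (2 ^ (n + 2))) (hij : i ≠ j) :
    3 * radius (n + 1) ≤ dist (child c n i) (child c n j) := by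
  have hN : (4 : ℝ) ≤ (2 ^ (n + 2) : ℕ) := by
    rw [pow_add]
    exact_mod_cast Nat.le_mul_of_pos_left 4 (Nat.two_pow_pos n)
  have hfactor : (3 : ℝ) / 4 ≤ 1 - 1 / (2 ^ (n + 2) : ℕ) := by
    linarith [one_div_le_one_div_of_le four_pos hN]
  have hr := radius_pos n
  refine le_trans ?_ (div_le_dist_polygonVertex c
    (mul_nonneg hr.le (le_trans (by norm_num) hfactor)) hi hj hij)
  calc 3 * radius (n + 1) = 4 * (radius n * (3 / 4)) / (2 ^ (n + 2) : ℕ) := by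
        rw [radius]
        push_cast
        ring
    _ ≤ _ := by gcongr

lemma mem_descendants_succ {c x : ℂ} {n d : ℕ} : x ∈ descendants c n (d + 1) ↔
    ∃ j ∈ Finset.Icc 1 (2 ^ (n + 2)), x ∈ descendants (child c n j) (n + 1) d := by
  rw [descendants, Finset.mem_biUnion]

lemma mem_descendants_succ' {c x : ℂ} {n d : ℕ} : x ∈ descendants c n (d + 1) ↔
    ∃ y ∈ descendants c n d, ∃ j ∈ Finset.Icc 1 (2 ^ (n + d + 2)), child y (n + d) j = x := by
  induction d generalizing c n with
  | zero => simp [descendants, eq_comm]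
  | succ d ih =>
    rw [mem_descendants_succ, show n + (d + 1) = n + 1 + d by ring]
    simp only [ih, mem_descendants_succ (d := d)]
    tauto

lemma closedBall_descendant_subset {c x : ℂ} {n d : ℕ} (hx : x ∈ descendants c n d) {l : ℝ}
    (hl : 1 ≤ l) : closedBall x (l * radius (n + d)) ⊆ closedBall c (l * radius n) := by
  induction d generalizing c n with
  | zero => rw [Finset.mem_singleton.1 hx, add_zero]
  | succ d ih =>
    obtain ⟨j, -, hj⟩ := mem_descendants_succ.1 hx
    rw [← add_assoc, add_right_comm]
    exact (ih hj).trans (closedBall_child_subset c n j hl)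

lemma pairwiseDisjoint_closedBall_child (c : ℂ) (n : ℕ) {l : ℝ} (hl : l < 3 / 2) :
    (Finset.Icc 1 (2 ^ (n + 2)) : Set ℕ).PairwiseDisjoint
      fun j => closedBall (child c n j) (l * radius (n + 1)) := fun i hi j hj hij =>
  closedBall_disjoint_closedBall <| by
    nlinarith [three_mul_radius_le_dist_child c n hi hj hij, radius_pos (n + 1)]

lemma pairwiseDisjoint_closedBall_descendants (c : ℂ) (n d : ℕ) {l : ℝ} (hl : 1 ≤ l)
    (hl' : l < 3 / 2) :
    (descendants c n d : Set ℂ).PairwiseDisjoint fun x => closedBall x (l * radius (n + d)) := by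
  induction d generalizing c n with
  | zero => simp [descendants]
  | succ d ih =>
    intro x hx y hy hxy
    obtain ⟨i, hi, hx'⟩ := mem_descendants_succ.1 hx
    obtain ⟨j, hj, hy'⟩ := mem_descendants_succ.1 hy
    rw [Function.onFun, ← add_assoc, add_right_comm]
    rcases eq_or_ne i j with rfl | hij
    · exact ih _ _ hx' hy' hxy
    · exact (pairwiseDisjoint_closedBall_child c n hl' hi hj hij).mono
        (closedBall_descendant_subset hx' hl) (closedBall_descendant_subset hy' hl)

lemma pairwiseDisjoint_descendants_child (c : ℂ) (n d : ℕ) :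
    (Finset.Icc 1 (2 ^ (n + 2)) : Set ℕ).PairwiseDisjoint
      fun j => descendants (child c n j) (n + 1) d := by
  intro i hi j hj hij
  refine Finset.disjoint_left.2 fun x hxi hxj => ?_
  have hx : x ∈ closedBall x (1 * radius (n + 1 + d)) :=
    mem_closedBall_self (by rw [one_mul]; exact (radius_pos _).le)
  exact disjoint_left.1 (pairwiseDisjoint_closedBall_child c n (by norm_num) hi hj hij)
    (closedBall_descendant_subset hxi le_rfl hx) (closedBall_descendant_subset hxj le_rfl hx)

lemma card_descendants_mul_radius (c : ℂ) (n d : ℕ) :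
    (descendants c n d).card * radius (n + d) = radius n := by
  induction d generalizing c n with
  | zero => simp [descendants]
  | succ d ih =>
    rw [descendants, Finset.card_biUnion (pairwiseDisjoint_descendants_child c n d),
      Nat.cast_sum, Finset.sum_mul, ← add_assoc, add_right_comm,
      Finset.sum_congr rfl fun j _ => ih (child c n j) (n + 1), Finset.sum_const, Nat.card_Icc,
      radius, nsmul_eq_mul]
    push_cast
    field

/-- The centre of the disc of level `d + 1` with address `j 2, …, j (d + 1)`. -/
noncomputable def wordCenter (j : ℕ → ℕ) : ℕ → ℂ
  | 0 => 0
  | d + 1 => child (wordCenter j d) d (j (d + 2))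

lemma add_radius_mul_f (c z : ℂ) (n j : ℕ) :
    c + radius n * f (n + 2) j z = child c n j + radius (n + 1) * z := by
  rw [child, polygonVertex, circleMap, f, radius]
  have hangle : (j : ℂ) * (2 / 2 ^ (n + 2)) * π = (2 * π * j / (2 ^ (n + 2) : ℕ) : ℝ) := by
    push_cast
    ring
  rw [hangle]
  push_cast
  ring

lemma wordMap_succ_eq (j : ℕ → ℕ) (d : ℕ) (z : ℂ) :
    wordMap j (d + 1) z = wordCenter j d + radius d * z := by
  induction d generalizing z with
  | zero => simp [wordMap, wordCenter, radius]
  | succ d ih => rw [wordMap, Function.comp_apply, ih, add_radius_mul_f, wordCenter]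

lemma wordCenter_congr {j j' : ℕ → ℕ} {d : ℕ} (h : ∀ i ≤ d + 1, j i = j' i) :
    wordCenter j d = wordCenter j' d := by
  induction d with
  | zero => rfl
  | succ d ih => rw [wordCenter, wordCenter, ih fun i hi => h i (by omega), h (d + 2) le_rfl]

lemma mem_descendants_zero_iff {d : ℕ} {c : ℂ} : c ∈ descendants 0 0 d ↔
    ∃ j : ℕ → ℕ, (∀ i, 2 ≤ i → i ≤ d + 1 → 1 ≤ j i ∧ j i ≤ 2 ^ i) ∧ wordCenter j d = c := by
  induction d generalizing c with
  | zero =>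
    refine Finset.mem_singleton.trans ⟨?_, ?_⟩
    · rintro rfl
      exact ⟨0, by omega, rfl⟩
    · rintro ⟨j, -, rfl⟩
      rfl
  | succ d ih =>
    rw [mem_descendants_succ', zero_add]
    constructor
    · rintro ⟨y, hy, i, hi, rfl⟩
      obtain ⟨j, hj, rfl⟩ := ih.1 hy
      refine ⟨Function.update j (d + 2) i, fun l hl hld => ?_, ?_⟩
      · rcases eq_or_ne l (d + 2) with rfl | hne
        · rw [Function.update_self]
          exact Finset.mem_Icc.1 hi
        · rw [Function.update_of_ne hne]
          exact hj l hl (by omega)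
      · rw [wordCenter, Function.update_self,
          wordCenter_congr fun l hl => Function.update_of_ne (by omega) i j]
    · rintro ⟨j, hj, rfl⟩
      exact ⟨wordCenter j d, ih.2 ⟨j, fun i hi hid => hj i hi (by omega), rfl⟩, j (d + 2),
        Finset.mem_Icc.2 (hj (d + 2) (by omega) le_rfl), rfl⟩

lemma image_wordMap_closedBall (j : ℕ → ℕ) (d : ℕ) :
    wordMap j (d + 1) '' closedBall 0 1 = closedBall (wordCenter j d) (radius d) := by
  have hpos := (radius_pos d).le
  rw [← affinity_unitClosedBall hpos, ← image_smul, ← image_vadd, image_image]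
  exact image_congr fun z _ => wordMap_succ_eq j d z

lemma level_succ_eq (n : ℕ) :
    level (n + 1) = ⋃ c ∈ descendants 0 0 n, closedBall c (radius n) := by
  ext x
  simp only [level, image_wordMap_closedBall, mem_iUnion₂, mem_descendants_zero_iff, mem_ofPred_eq,
    exists_prop]
  aesop

lemma level_succ_subset (n : ℕ) : level (n + 1 + 1) ⊆ level (n + 1) := by
  rw [level_succ_eq, level_succ_eq]
  refine iUnion₂_subset fun c hc => ?_
  obtain ⟨y, hy, j, -, rfl⟩ := mem_descendants_succ'.1 hc
  have hsub := closedBall_child_subset y n j le_rfl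
  rw [one_mul, one_mul] at hsub
  rw [zero_add]
  exact hsub.trans (subset_biUnion_of_mem (u := fun c => closedBall c (radius n)) hy)

lemma isCompact_level_succ (n : ℕ) : IsCompact (level (n + 1)) := by
  rw [level_succ_eq]
  exact (descendants 0 0 n).isCompact_biUnion fun c _ => isCompact_closedBall c _

lemma circlesOfBalls_eq_iInter : circlesOfBalls = ⋂ n, level (n + 1) := by
  refine subset_antisymm (subset_iInter fun n => biInter_subset_of_mem (Nat.le_add_left 1 n))
    (subset_iInter₂ fun k hk => ?_)
  obtain ⟨n, rfl⟩ := Nat.exists_eq_add_of_le' hk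
  exact iInter_subset _ n

lemma circlesOfBalls_subset_biUnion (n : ℕ) :
    circlesOfBalls ⊆ ⋃ c ∈ descendants 0 0 n, closedBall c (radius n) := by
  rw [← level_succ_eq, circlesOfBalls_eq_iInter]
  exact iInter_subset _ n

lemma isCompact_circlesOfBalls : IsCompact circlesOfBalls := by
  rw [circlesOfBalls_eq_iInter]
  exact (isCompact_level_succ 0).of_isClosed_subset
    (isClosed_iInter fun n => (isCompact_level_succ n).isClosed) (iInter_subset _ 0)

lemma exists_level_subset {U : Set ℂ} (hU : IsOpen U) (h : circlesOfBalls ⊆ U) :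
    ∃ n, level (n + 1) ⊆ U :=
  exists_subset_nhds_of_isCompact
    (antitone_nat_of_succ_le (f := fun n => level (n + 1)) level_succ_subset).directed_ge
    isCompact_level_succ fun _ hx => hU.mem_nhds (h (circlesOfBalls_eq_iInter ▸ hx))

lemma isTotallyDisconnected_circlesOfBalls : IsTotallyDisconnected circlesOfBalls := by
  intro t ht hpre x hx y hy
  by_contra hxy
  obtain ⟨n, hn⟩ := (tendsto_radius.eventually (gt_mem_nhds (half_pos (dist_pos.2 hxy)))).exists
  have hdisj := pairwiseDisjoint_closedBall_descendants 0 0 n le_rfl (by norm_num)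
  simp only [one_mul, zero_add] at hdisj
  obtain ⟨c, -, hc⟩ := exists_subset_of_isPreconnected_of_pairwiseDisjoint hpre ⟨x, hx⟩
    (fun _ _ => isClosed_closedBall) hdisj (ht.trans (circlesOfBalls_subset_biUnion n))
  linarith [dist_triangle_right x y c, mem_closedBall.1 (hc hx), mem_closedBall.1 (hc hy)]

end Construction

section Mass

open Classical in
/-- The total radius of the discs of level `n + d + 1` that lie in `A`, among those in the disc of
level `n + 1` with centre `c`. Discs of level `n + d + 1` that `A` meets without containing them
are not counted. -/
noncomputable def mass (A : Set ℂ) (c : ℂ) (n d : ℕ) : ℝ :=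
  {x ∈ descendants c n d | closedBall x (radius (n + d)) ⊆ A}.card * radius (n + d)

open Classical in
/-- The indices of the discs of level `n + 2` that meet `A`, among those in the disc of level
`n + 1` with centre `c`. -/
noncomputable def metChildren (A : Set ℂ) (c : ℂ) (n : ℕ) : Finset ℕ :=
  {j ∈ Finset.Icc 1 (2 ^ (n + 2)) | (A ∩ closedBall (child c n j) (radius (n + 1))).Nonempty}

variable {A : Set ℂ} {c : ℂ} {n d : ℕ}

lemma mass_nonneg : 0 ≤ mass A c n d := mul_nonneg (Nat.cast_nonneg _) (radius_pos _).le

lemma mass_le_radius : mass A c n d ≤ radius n := by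
  classical
  rw [← card_descendants_mul_radius c n d, mass]
  have := (radius_pos (n + d)).le
  gcongr
  exact Finset.filter_subset _ _

lemma closedBall_descendant_subset_closedBall {x : ℂ} (hx : x ∈ descendants c n d) :
    closedBall x (radius (n + d)) ⊆ closedBall c (radius n) := by
  simpa only [one_mul] using closedBall_descendant_subset hx le_rfl

lemma mass_inter_closedBall (A : Set ℂ) (c : ℂ) (n d : ℕ) :
    mass (A ∩ closedBall c (radius n)) c n d = mass A c n d := by
  classical
  rw [mass, mass]
  congr 3
  refine Finset.filter_congr fun x hx => ?_
  rw [subset_inter_iff, and_iff_left (closedBall_descendant_subset_closedBall hx)]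

lemma nonempty_of_mass_ne_zero (h : mass A c n d ≠ 0) : (A ∩ closedBall c (radius n)).Nonempty := by
  classical
  rw [mass, mul_ne_zero_iff, Nat.cast_ne_zero, Finset.card_ne_zero] at h
  obtain ⟨x, hx⟩ := h.1
  obtain ⟨hxd, hxA⟩ := Finset.mem_filter.1 hx
  have hxx : x ∈ closedBall x (radius (n + d)) := mem_closedBall_self (radius_pos _).le
  exact ⟨x, hxA hxx, closedBall_descendant_subset_closedBall hxd hxx⟩

lemma mass_succ_le_sum_metChildren (A : Set ℂ) (c : ℂ) (n d : ℕ) :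
    mass A c n (d + 1) ≤ ∑ j ∈ metChildren A c n, mass A (child c n j) (n + 1) d := by
  classical
  rw [metChildren, Finset.sum_filter_of_ne fun j _ h => nonempty_of_mass_ne_zero h]
  simp only [mass, ← add_assoc, add_right_comm n 1 d]
  rw [← Finset.sum_mul, ← Nat.cast_sum, descendants, Finset.filter_biUnion]
  have := (radius_pos (n + d + 1)).le
  gcongr
  exact Finset.card_biUnion_le

lemma radius_le_sum_mass {ι : Type*} (s : Finset ι) (D : ι → Set ℂ)
    (h : ∀ x ∈ descendants c n d, ∃ i ∈ s, closedBall x (radius (n + d)) ⊆ D i) :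
    radius n ≤ ∑ i ∈ s, mass (D i) c n d := by
  classical
  simp only [mass]
  rw [← card_descendants_mul_radius c n d, ← Finset.sum_mul, ← Nat.cast_sum]
  have := (radius_pos (n + d)).le
  gcongr
  refine (Finset.card_le_card fun x hx => ?_).trans Finset.card_biUnion_le
  obtain ⟨i, hi, hxi⟩ := h x hx
  exact Finset.mem_biUnion.2 ⟨i, hi, Finset.mem_filter.2 ⟨hx, hxi⟩⟩

lemma metChildren_subset : metChildren A c n ⊆ Finset.Icc 1 (2 ^ (n + 2)) := by
  classical exact Finset.filter_subset _ _

lemma nonempty_of_mem_metChildren {j : ℕ} (hj : j ∈ metChildren A c n) :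
    (A ∩ closedBall (child c n j) (radius (n + 1))).Nonempty := by
  classical exact (Finset.mem_filter.1 hj).2

lemma radius_succ_le_diam (hA : IsBounded A) (h : 1 < (metChildren A c n).card) :
    radius (n + 1) ≤ diam A := by
  obtain ⟨i, hi, j, hj, hij⟩ := Finset.one_lt_card.1 h
  obtain ⟨z, hzA, hz⟩ := nonempty_of_mem_metChildren hi
  obtain ⟨w, hwA, hw⟩ := nonempty_of_mem_metChildren hj
  rw [mem_closedBall] at hz hw
  linarith [three_mul_radius_le_dist_child c n (metChildren_subset hi) (metChildren_subset hj) hij,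
    dist_le_diam_of_mem hA hzA hwA, dist_triangle4 (child c n i) z w (child c n j),
    dist_comm z (child c n i)]

lemma exists_far_child_pair (c : ℂ) (hn : 2 ≤ n) {J : Finset ℕ}
    (hJ : J ⊆ Finset.Icc 1 (2 ^ (n + 2))) (hJ1 : 1 < J.card) (hcard : 2 * J.card ≤ 2 ^ (n + 2)) :
    ∃ a ∈ J, ∃ b ∈ J, a ≠ b ∧
      π * (J.card - 1) * radius (n + 1) ≤ dist (child c n a) (child c n b) := by
  have hN : (16 : ℝ) ≤ (2 ^ (n + 2) : ℕ) := by
    exact_mod_cast Nat.pow_le_pow_right two_pos (show 4 ≤ n + 2 by omega)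
  have hfactor : 15 / 16 ≤ 1 - 1 / ((2 ^ (n + 2) : ℕ) : ℝ) := by
    linarith [one_div_le_one_div_of_le (by norm_num) hN]
  have hr := radius_pos n
  have hJ1' : (1 : ℝ) < J.card := mod_cast hJ1
  obtain ⟨a, ha, b, hb, hab⟩ := exists_far_polygonVertex_pair c
    (mul_nonneg hr.le (le_trans (by norm_num) hfactor)) hJ (Finset.card_pos.1 (by omega)) hcard
  have hfar : π * (J.card - 1) * radius (n + 1) ≤ dist (child c n a) (child c n b) := by
    refine le_trans ?_ hab
    have hsqrt : 1.7 ≤ √3 := Real.le_sqrt_of_sq_le (by norm_num)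
    have hconst : π ≤ 2 * √3 * (1 - 1 / ((2 ^ (n + 2) : ℕ) : ℝ)) := by
      nlinarith [Real.pi_lt_d2]
    calc π * (J.card - 1) * radius (n + 1)
        = π * (radius n * (J.card - 1) / (2 ^ (n + 2) : ℕ)) := by
          rw [radius]
          push_cast
          ring
      _ ≤ 2 * √3 * (1 - 1 / ((2 ^ (n + 2) : ℕ) : ℝ)) *
            (radius n * (J.card - 1) / (2 ^ (n + 2) : ℕ)) := by
          have := sub_pos.2 hJ1'
          gcongr
      _ = _ := by ring
  refine ⟨a, ha, b, hb, ?_, hfar⟩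
  rintro rfl
  rw [dist_self] at hfar
  have := mul_pos (mul_pos Real.pi_pos (sub_pos.2 hJ1')) (radius_pos (n + 1))
  linarith

lemma sum_le_hullPerimeter_of_few (hA : IsBounded A) (hn : 2 ≤ n)
    (h1 : 1 < (metChildren A c n).card) (hfew : 2 * (metChildren A c n).card ≤ 2 ^ (n + 2))
    {m : ℕ → ℝ} (hm : ∀ j ∈ metChildren A c n, m j ≤ 2 * π * radius (n + 1))
    (hm' : ∀ j ∈ metChildren A c n,
      m j ≤ hullPerimeter (A ∩ closedBall (child c n j) (radius (n + 1)))) :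
    ∑ j ∈ metChildren A c n, m j ≤ hullPerimeter A := by
  obtain ⟨a, ha, b, hb, hab, hfar⟩ := exists_far_child_pair c hn metChildren_subset h1 hfew
  have hpair := hullPerimeter_add_le hA inter_subset_left inter_subset_left
    (nonempty_of_mem_metChildren ha) (nonempty_of_mem_metChildren hb) inter_subset_right
    inter_subset_right
  rw [← dist_eq_norm, dist_comm] at hpair
  have hb' := Finset.mem_erase.2 ⟨hab.symm, hb⟩
  have hrest : ∑ j ∈ ((metChildren A c n).erase a).erase b, m j ≤
      ((metChildren A c n).card - 2) * (2 * π * radius (n + 1)) := by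
    refine (Finset.sum_le_card_nsmul _ _ _ fun j hj =>
      hm j (Finset.mem_of_mem_erase (Finset.mem_of_mem_erase hj))).trans_eq ?_
    rw [Finset.card_erase_of_mem hb', Finset.card_erase_of_mem ha, Nat.sub_sub, nsmul_eq_mul,
      Nat.cast_sub h1]
    norm_num
  rw [← Finset.add_sum_erase _ m ha, ← Finset.add_sum_erase _ m hb']
  linarith [hm' a ha, hm' b hb]

lemma card_mul_radius_le_hullPerimeter_of_many (hA : IsBounded A) (hn : 2 ≤ n)
    (hmany : 2 ^ (n + 2) < 2 * (metChildren A c n).card) :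
    2 * π * (1 - 1 / 2 ^ n) * ((metChildren A c n).card * radius (n + 1)) ≤ hullPerimeter A := by
  have hN : 5 ≤ 2 ^ (n + 2) :=
    le_trans (by norm_num) (Nat.pow_le_pow_right two_pos (show 4 ≤ n + 2 by omega))
  have hmeet : ∀ j ∈ metChildren A c n, (A ∩ closedBall (polygonVertex c
      (radius n * (1 - 1 / (2 ^ (n + 2) : ℕ))) (2 ^ (n + 2)) j)
        (radius n / (2 ^ (n + 2) : ℕ))).Nonempty := fun j hj => by
    simpa [child, radius] using nonempty_of_mem_metChildren hj
  refine le_of_eq_of_le ?_ (mul_card_div_le_hullPerimeter_of_polygon hA (radius_pos n).le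
    (even_two.pow_of_ne_zero (by omega)) hN metChildren_subset hmany hmeet)
  rw [radius]
  push_cast
  ring

lemma two_pi_mul_mass_zero_le (hA : IsBounded A) : 2 * π * mass A c n 0 ≤ hullPerimeter A := by
  classical
  rw [mass, descendants, Finset.filter_singleton]
  split_ifs with h
  · rw [Finset.card_singleton, Nat.cast_one, one_mul]
    exact (two_pi_mul_le_hullPerimeter_closedBall c (radius_pos _).le).trans
      (hullPerimeter_mono hA h)
  · simpa using hullPerimeter_nonneg hA

lemma one_sub_one_div_two_pow_nonneg (n : ℕ) : (0 : ℝ) ≤ 1 - 1 / 2 ^ n :=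
  sub_nonneg.2 (div_le_one_of_le₀ (one_le_pow₀ one_le_two) (by positivity))

/-- A set of small diameter meets two discs of the same generation only from level `n₀ + 2` on. If
it meets at most half of the discs in their common parent, two of them are so far apart that the
gap pays for all the others; otherwise its hull almost fills the parent. -/
lemma two_pi_mul_mass_le_hullPerimeter {n₀ : ℕ} (hn₀ : 2 ≤ n₀) (d : ℕ) (hA : IsBounded A)
    (hdiam : diam A < radius n₀) (c : ℂ) (n : ℕ) :
    2 * π * (1 - 1 / 2 ^ n₀) * mass A c n d ≤ hullPerimeter A := by
  have hq := one_sub_one_div_two_pow_nonneg n₀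
  have hq1 : 1 - 1 / 2 ^ n₀ ≤ (1 : ℝ) := sub_le_self _ (by positivity)
  induction d generalizing A c n with
  | zero =>
    exact (mul_le_mul_of_nonneg_right (mul_le_of_le_one_right (by positivity) hq1)
      mass_nonneg).trans (two_pi_mul_mass_zero_le hA)
  | succ d ih =>
    have hchild : ∀ j, 2 * π * (1 - 1 / 2 ^ n₀) * mass A (child c n j) (n + 1) d ≤
        hullPerimeter (A ∩ closedBall (child c n j) (radius (n + 1))) := fun j => by
      rw [← mass_inter_closedBall]
      exact ih (hA.subset inter_subset_left)
        ((diam_mono inter_subset_left hA).trans_lt hdiam) _ _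
    refine (mul_le_mul_of_nonneg_left (mass_succ_le_sum_metChildren A c n d)
      (by positivity)).trans ?_
    rcases le_or_gt (metChildren A c n).card 1 with hle | hgt
    · obtain ⟨j, hj⟩ := Finset.card_le_one_iff_subset_singleton.1 hle
      rcases Finset.subset_singleton_iff.1 hj with h | h <;> rw [h]
      · simpa using hullPerimeter_nonneg hA
      · rw [Finset.sum_singleton]
        exact (hchild j).trans (hullPerimeter_mono hA inter_subset_left)
    have hn : n₀ ≤ n := by
      by_contra hlt
      linarith [antitone_radius (show n + 1 ≤ n₀ by omega), radius_succ_le_diam hA hgt]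
    rcases le_or_gt (2 * (metChildren A c n).card) (2 ^ (n + 2)) with hfew | hmany
    · rw [Finset.mul_sum]
      refine sum_le_hullPerimeter_of_few hA (hn₀.trans hn) hgt hfew (fun j _ => ?_)
        fun j _ => hchild j
      exact mul_le_mul (mul_le_of_le_one_right (by positivity) hq1) mass_le_radius mass_nonneg
        (by positivity)
    · refine le_trans ?_ (card_mul_radius_le_hullPerimeter_of_many hA (hn₀.trans hn) hmany)
      rw [← nsmul_eq_mul]
      gcongr
      · exact Finset.sum_nonneg fun j _ => mass_nonneg
      · exact mul_nonneg (by positivity) (one_sub_one_div_two_pow_nonneg n)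
      · exact one_le_two
      · exact Finset.sum_le_card_nsmul _ _ _ fun j _ => mass_le_radius

end Mass

section Hausdorff

lemma le_hausdorffMeasure_one_of_forall_open_cover {X : Type*} [EMetricSpace X]
    [MeasurableSpace X] [BorelSpace X] {K : Set X} {δ a : ℝ≥0∞} (hδ : δ ≠ 0)
    (h : ∀ O : ℕ → Set X, (∀ i, IsOpen (O i)) → (∀ i, ediam (O i) ≤ δ) → K ⊆ ⋃ i, O i →
      a ≤ ∑' i, ediam (O i)) : a ≤ μH[1] K := by
  have hδ2 : δ / 2 ≠ 0 := (ENNReal.half_pos hδ).ne'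
  rw [Measure.hausdorffMeasure_apply]
  refine le_iSup₂_of_le (δ / 2) (pos_iff_ne_zero.2 hδ2) (le_iInf fun t => le_iInf fun hKt =>
    le_iInf fun ht => ENNReal.le_of_forall_pos_le_add fun ε hε _ => ?_)
  obtain ⟨η, hη, hηsum⟩ := ENNReal.exists_pos_sum_of_countable
    (lt_min (ENNReal.coe_pos.2 hε) (pos_iff_ne_zero.2 hδ2)).ne' ℕ
  have hdiam : ∀ i, ediam (thickening (η i / 2 : NNReal) (t i)) ≤ ediam (t i) + η i := fun i => by
    refine (ediam_thickening_le _).trans_eq ?_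
    rw [ENNReal.coe_div two_ne_zero, ENNReal.coe_ofNat,
      ENNReal.mul_div_cancel two_ne_zero ENNReal.ofNat_ne_top]
  calc a ≤ ∑' i, ediam (thickening (η i / 2 : NNReal) (t i)) := by
        refine h _ (fun i => isOpen_thickening) (fun i => ?_)
          (hKt.trans (iUnion_mono fun i => self_subset_thickening (half_pos (hη i)) _))
        refine (hdiam i).trans ((add_le_add (ht i) ?_).trans_eq (ENNReal.add_halves δ))
        exact (ENNReal.le_tsum i).trans (hηsum.le.trans (min_le_right _ _))
    _ ≤ ∑' i, ((⨆ _ : (t i).Nonempty, ediam (t i) ^ (1 : ℝ)) + η i) := by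
        refine ENNReal.tsum_le_tsum fun i => ?_
        rcases (t i).eq_empty_or_nonempty with hempty | hne
        · simp [hempty]
        · rw [ciSup_pos hne, ENNReal.rpow_one]
          exact hdiam i
    _ ≤ _ := by
        rw [ENNReal.tsum_add]
        gcongr
        exact hηsum.le.trans (min_le_left _ _)

lemma closedBall_subset_level_succ {n : ℕ} {x : ℂ} (hx : x ∈ descendants 0 0 n) :
    closedBall x (radius n) ⊆ level (n + 1) := by
  rw [level_succ_eq]
  exact subset_biUnion_of_mem (u := fun c => closedBall c (radius n)) hx

lemma exists_forall_closedBall_subset {ι : Type*} {O : ι → Set ℂ} (hO : ∀ i, IsOpen (O i))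
    (h : circlesOfBalls ⊆ ⋃ i, O i) (l : ℝ) :
    ∃ n, ∀ x ∈ descendants 0 0 n, ∃ i, closedBall x (l * radius n) ⊆ O i := by
  obtain ⟨m, hm⟩ := exists_level_subset (isOpen_iUnion hO) h
  obtain ⟨δ, hδ, hball⟩ := lebesgue_number_lemma_of_metric (isCompact_level_succ m) hO hm
  have htendsto : Filter.Tendsto (fun n => l * radius n) Filter.atTop (nhds 0) := by
    simpa using tendsto_radius.const_mul l
  obtain ⟨n, hmn, hn⟩ := ((Filter.eventually_ge_atTop m).and
    (htendsto.eventually (gt_mem_nhds hδ))).exists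
  refine ⟨n, fun x hx => ?_⟩
  have hlevel : level (n + 1) ⊆ level (m + 1) :=
    antitone_nat_of_succ_le (f := fun n => level (n + 1)) level_succ_subset hmn
  obtain ⟨i, hi⟩ := hball x
    (hlevel (closedBall_subset_level_succ hx (mem_closedBall_self (radius_pos n).le)))
  exact ⟨i, (closedBall_subset_ball hn).trans hi⟩

lemma two_pi_mul_le_sum_hullPerimeter {ι : Type*} {s : Finset ι} {D : ι → Set ℂ} {n₀ n : ℕ}
    (hn₀ : 2 ≤ n₀) (hD : ∀ i ∈ s, IsBounded (D i)) (hdiam : ∀ i ∈ s, diam (D i) < radius n₀)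
    (h : ∀ x ∈ descendants 0 0 n, ∃ i ∈ s, closedBall x (radius n) ⊆ D i) :
    2 * π * (1 - 1 / 2 ^ n₀) ≤ ∑ i ∈ s, hullPerimeter (D i) := by
  have hmass : 1 ≤ ∑ i ∈ s, mass (D i) 0 0 n := radius_le_sum_mass (n := 0) s D (by simpa using h)
  calc 2 * π * (1 - 1 / 2 ^ n₀) ≤ 2 * π * (1 - 1 / 2 ^ n₀) * ∑ i ∈ s, mass (D i) 0 0 n :=
        le_mul_of_one_le_right
          (mul_nonneg (by positivity) (one_sub_one_div_two_pow_nonneg n₀)) hmass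
    _ = ∑ i ∈ s, 2 * π * (1 - 1 / 2 ^ n₀) * mass (D i) 0 0 n := Finset.mul_sum _ _ _
    _ ≤ _ := Finset.sum_le_sum fun i hi =>
      two_pi_mul_mass_le_hullPerimeter hn₀ n (hD i hi) (hdiam i hi) 0 0

lemma ofReal_le_of_forall_mul_one_sub_le {a : ℝ} {x : ℝ≥0∞} {m : ℕ}
    (h : ∀ n, m ≤ n → ENNReal.ofReal (a * (1 - 1 / 2 ^ n)) ≤ x) : ENNReal.ofReal a ≤ x := by
  have hlim : Filter.Tendsto (fun n : ℕ => 1 / (2 : ℝ) ^ n) Filter.atTop (nhds 0) :=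
    tendsto_const_nhds.div_atTop (tendsto_pow_atTop_atTop_of_one_lt one_lt_two)
  have hlim' := ENNReal.tendsto_ofReal ((hlim.const_sub 1).const_mul a)
  rw [sub_zero, mul_one] at hlim'
  exact le_of_tendsto hlim' ((Filter.eventually_ge_atTop m).mono h)

lemma le_hausdorffMeasure_circlesOfBalls : 2 ≤ μH[1] circlesOfBalls := by
  classical
  rw [← ENNReal.ofReal_ofNat]
  refine ofReal_le_of_forall_mul_one_sub_le (m := 2) fun n₀ hn₀ => ?_
  have hr := radius_pos n₀
  refine le_hausdorffMeasure_one_of_forall_open_cover (δ := ENNReal.ofReal (radius n₀ / 2))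
    (by simpa using hr) fun O hO hediam hcover => ?_
  have hbdd : ∀ i, IsBounded (O i) := fun i =>
    isBounded_iff_ediam_ne_top.2 ((hediam i).trans_lt ENNReal.ofReal_lt_top).ne
  have hdiam : ∀ i, diam (O i) < radius n₀ := fun i =>
    (ENNReal.toReal_le_of_le_ofReal (half_pos hr).le (hediam i)).trans_lt (half_lt_self hr)
  obtain ⟨n, hn⟩ := exists_forall_closedBall_subset hO hcover 1
  simp only [one_mul] at hn
  choose! i hi using hn
  have hsum := two_pi_mul_le_sum_hullPerimeter hn₀ (fun j _ => hbdd j) (fun j _ => hdiam j)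
    fun x hx => ⟨i x, Finset.mem_image_of_mem i hx, hi x hx⟩
  have hdiamsum : 2 * (1 - 1 / 2 ^ n₀) ≤ ∑ j ∈ (descendants 0 0 n).image i, diam (O j) := by
    refine le_of_mul_le_mul_left ?_ Real.pi_pos
    rw [Finset.mul_sum]
    linarith [Finset.sum_le_sum fun j (_ : j ∈ (descendants 0 0 n).image i) =>
      hullPerimeter_le_pi_mul_diam (hbdd j)]
  calc ENNReal.ofReal (2 * (1 - 1 / 2 ^ n₀))
      ≤ ENNReal.ofReal (∑ j ∈ (descendants 0 0 n).image i, diam (O j)) :=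
        ENNReal.ofReal_le_ofReal hdiamsum
    _ = ∑ j ∈ (descendants 0 0 n).image i, ediam (O j) := by
        rw [ENNReal.ofReal_sum_of_nonneg fun _ _ => diam_nonneg]
        exact Finset.sum_congr rfl fun j _ => ENNReal.ofReal_toReal (hbdd j).ediam_ne_top
    _ ≤ _ := ENNReal.sum_le_tsum _

lemma hausdorffMeasure_circlesOfBalls_le : μH[1] circlesOfBalls ≤ 2 := by
  have hdiam : ∀ n (c : descendants 0 0 n),
      ediam (closedBall (c : ℂ) (radius n)) ≤ 2 * ENNReal.ofReal (radius n) := fun n c => by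
    rw [← closedEBall_ofReal (radius_pos n).le]
    exact ediam_closedEBall_le
  have htendsto : Filter.Tendsto (fun n => 2 * ENNReal.ofReal (radius n)) Filter.atTop
      (nhds 0) := by
    simpa using ENNReal.Tendsto.const_mul (a := 2) (ENNReal.tendsto_ofReal tendsto_radius)
      (Or.inr ENNReal.ofNat_ne_top)
  refine (Measure.hausdorffMeasure_le_liminf_sum (ι := fun n => descendants 0 0 n) 1 _ _ htendsto
    (fun n c => closedBall (c : ℂ) (radius n)) (.of_forall hdiam) (.of_forall fun n => ?_)).trans ?_
  · simpa only [iUnion_subtype] using circlesOfBalls_subset_biUnion n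
  · refine (Filter.liminf_le_liminf (.of_forall fun n => ?_)).trans_eq
      (Filter.liminf_const (f := Filter.atTop (α := ℕ)) 2)
    calc ∑ c : descendants 0 0 n, ediam (closedBall (c : ℂ) (radius n)) ^ (1 : ℝ)
        ≤ ∑ _c : descendants 0 0 n, 2 * ENNReal.ofReal (radius n) :=
          Finset.sum_le_sum fun c _ => (ENNReal.rpow_one _).trans_le (hdiam n c)
      _ = 2 * ENNReal.ofReal ((descendants 0 0 n).card * radius n) := by
          rw [Finset.sum_const, Finset.card_univ, Fintype.card_coe, nsmul_eq_mul,
            ENNReal.ofReal_mul (Nat.cast_nonneg _), ENNReal.ofReal_natCast]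
          ring
      _ = 2 := by
          have hcard := card_descendants_mul_radius 0 0 n
          rw [zero_add] at hcard
          rw [hcard, radius, ENNReal.ofReal_one, mul_one]

end Hausdorff

section Kappa

lemma two_pi_mul_le_sum_hullPerimeter_of_subset_sUnion {s : Finset (Set ℂ)} {V : Set ℂ} {n₀ : ℕ}
    (hn₀ : 2 ≤ n₀) (hs : ∀ D ∈ s, IsCompact D) (hd : (s : Set (Set ℂ)).PairwiseDisjoint id)
    (hdiam : ∀ D ∈ s, diam D < radius n₀) (hV : IsOpen V) (hKV : circlesOfBalls ⊆ V)
    (hVs : V ⊆ ⋃₀ (s : Set (Set ℂ))) :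
    2 * π * (1 - 1 / 2 ^ n₀) ≤ ∑ D ∈ s, hullPerimeter D := by
  obtain ⟨n, hn⟩ := exists_level_subset hV hKV
  refine two_pi_mul_le_sum_hullPerimeter hn₀ (D := id) (n := n) (fun D hD => (hs D hD).isBounded)
    hdiam fun x hx => ?_
  refine exists_subset_of_isPreconnected_of_pairwiseDisjoint
    (convex_closedBall x (radius n)).isPreconnected (nonempty_closedBall.2 (radius_pos n).le)
    (fun D hD => (hs D hD).isClosed) hd ?_
  exact (closedBall_subset_level_succ hx).trans (hn.trans (hVs.trans_eq sUnion_eq_biUnion))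

lemma two_pi_mul_le_sum_hullPerimeter_of_frontier_eq {ι : Type*} [Fintype ι] {G : ι → Set ℂ}
    {V : Set ℂ} {n₀ : ℕ} (hn₀ : 2 ≤ n₀) (hV : IsOpen V) (hKV : circlesOfBalls ⊆ V)
    (hVW : V ⊆ ⋃ c ∈ descendants 0 0 (n₀ + 2), closedBall c (5 / 4 * radius (n₀ + 2)))
    (hG : ∀ i, IsConnected (G i)) (hfrontier : frontier V = ⋃ i, G i) :
    2 * π * (1 - 1 / 2 ^ n₀) ≤ ∑ i, hullPerimeter (G i) := by
  have hWbdd := (isBounded_biUnion_finset (descendants 0 0 (n₀ + 2))).2 fun c _ =>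
    isBounded_closedBall (x := c) (r := 5 / 4 * radius (n₀ + 2))
  have hWd := pairwiseDisjoint_closedBall_descendants 0 0 (n₀ + 2) (l := 5 / 4) (by norm_num)
    (by norm_num)
  rw [zero_add] at hWd
  have hfrontierW := frontier_subset_closure.trans
    (closure_minimal hVW (isClosed_biUnion_finset fun c _ => isClosed_closedBall))
  have hGfrontier : ∀ i, G i ⊆ frontier V := fun i => hfrontier ▸ subset_iUnion G i
  have hGW : ∀ i, ∃ c ∈ descendants 0 0 (n₀ + 2), G i ⊆ closedBall c (5 / 4 * radius (n₀ + 2)) :=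
    fun i => exists_subset_of_isPreconnected_of_pairwiseDisjoint (hG i).isPreconnected
      (hG i).nonempty (fun _ _ => isClosed_closedBall) hWd ((hGfrontier i).trans hfrontierW)
  obtain ⟨s, hs, hsd, hGs, hsum⟩ := exists_pairwiseDisjoint_convex_cover
    (fun i => hWbdd.subset ((hGfrontier i).trans hfrontierW)) (fun _ _ => isClosed_closedBall)
    (fun c _ => convex_closedBall c _) hWd hGW
  have hVs : V ⊆ ⋃₀ (s : Set (Set ℂ)) := by
    refine subset_of_frontier_subset_of_isPreconnected_compl hV (hWbdd.subset hVW)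
      ((isBounded_sUnion s.finite_toSet).2 fun D hD => (hs D hD).1.isBounded)
      (isPreconnected_compl_sUnion_of_convex ?_ s (fun D hD => ⟨(hs D hD).1, (hs D hD).2.1⟩) hsd)
      (hfrontier ▸ iUnion_subset hGs)
    rw [Complex.rank_real_complex]
    exact Nat.one_lt_ofNat
  refine (two_pi_mul_le_sum_hullPerimeter_of_subset_sUnion hn₀ (fun D hD => (hs D hD).1) hsd
    (fun D hD => ?_) hV hKV hVs).trans hsum
  obtain ⟨c, -, hDc⟩ := (hs D hD).2.2
  have hr := radius_pos (n₀ + 2)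
  linarith [diam_mono hDc isBounded_closedBall,
    diam_closedBall (x := c) (r := 5 / 4 * radius (n₀ + 2)) (by positivity),
    radius_succ_le_half n₀, radius_succ_le_half (n₀ + 1)]

lemma le_kappa_circlesOfBalls : ENNReal.ofReal (2 * π) ≤ kappa circlesOfBalls := by
  refine le_sInf fun l hl => ofReal_le_of_forall_mul_one_sub_le (m := 2) fun n₀ hn₀ => ?_
  have hK : circlesOfBalls ⊆
      ⋃ c ∈ descendants 0 0 (n₀ + 2), ball c (5 / 4 * radius (n₀ + 2)) :=
    (circlesOfBalls_subset_biUnion (n₀ + 2)).trans <| iUnion₂_mono fun c _ =>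
      closedBall_subset_ball (by linarith [radius_pos (n₀ + 2)])
  obtain ⟨V, hV, hKV, hVU, n, γ, hγ, -, hfrontier, hlength⟩ := hl _
    (isOpen_biUnion fun _ _ => isOpen_ball) hK
  have hcont : ∀ i, Continuous (γ i) := fun i => continuousOn_univ.1 (hγ i).analytic.continuousOn
  have hsum := two_pi_mul_le_sum_hullPerimeter_of_frontier_eq hn₀ hV hKV
    (hVU.trans (iUnion₂_mono fun c _ => ball_subset_closedBall))
    (fun i => isConnected_range (hcont i)) hfrontier
  calc ENNReal.ofReal (2 * π * (1 - 1 / 2 ^ n₀))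
      ≤ ENNReal.ofReal (∑ i, hullPerimeter (range (γ i))) := ENNReal.ofReal_le_ofReal hsum
    _ = ∑ i, ENNReal.ofReal (hullPerimeter (range (γ i))) :=
        ENNReal.ofReal_sum_of_nonneg fun i _ => hullPerimeter_nonneg
          ((hγ i).periodic.isBounded_of_continuous one_ne_zero (hcont i))
    _ ≤ ∑ i, curveLength (γ i) := Finset.sum_le_sum fun i _ =>
        hullPerimeter_range_le_curveLength (hcont i) (hγ i).periodic
    _ ≤ l := hlength

/-- The parametrisation of period `1` of the circle with centre `c` and radius `R`. -/
noncomputable def unitPeriodCircle (c : ℂ) (R t : ℝ) : ℂ := circleMap c R (2 * π * t)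

lemma range_unitPeriodCircle (c : ℂ) {R : ℝ} (hR : 0 ≤ R) :
    range (unitPeriodCircle c R) = sphere c R := by
  have hsurj : Function.Surjective fun t : ℝ => 2 * π * t :=
    mul_left_surjective₀ Real.two_pi_pos.ne'
  exact (hsurj.range_comp (circleMap c R)).trans (by rw [range_circleMap, abs_of_nonneg hR])

lemma isAnalyticJordanCurve_unitPeriodCircle (c : ℂ) {R : ℝ} (hR : R ≠ 0) :
    IsAnalyticJordanCurve (unitPeriodCircle c R) where
  analytic := (analyticOnNhd_circleMap c R).comp (analyticOnNhd_const.mul analyticOnNhd_id)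
    (mapsTo_univ _ _)
  periodic t := by rw [unitPeriodCircle, mul_add, mul_one, periodic_circleMap, unitPeriodCircle]
  injOn s hs t ht hst := by
    refine mul_left_cancel₀ Real.two_pi_pos.ne' (eq_of_circleMap_eq hR ?_ hst)
    rw [← mul_sub, abs_mul, abs_of_pos Real.two_pi_pos]
    refine mul_lt_of_lt_one_right Real.two_pi_pos (abs_lt.2 ⟨?_, ?_⟩)
    · linarith [hs.1, ht.2]
    · linarith [hs.2, ht.1]
  regular t := by
    have hderiv : HasDerivAt (unitPeriodCircle c R) _ t :=
      (hasDerivAt_circleMap c R (2 * π * t)).scomp t ((hasDerivAt_id t).const_mul (2 * π))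
    rw [hderiv.deriv, mul_one, ← deriv_circleMap c]
    exact smul_ne_zero Real.two_pi_pos.ne' (deriv_circleMap_ne_zero hR)

lemma curveLength_unitPeriodCircle_le (c : ℂ) {R : ℝ} (hR : 0 ≤ R) :
    curveLength (unitPeriodCircle c R) ≤ ENNReal.ofReal (2 * π * R) := by
  have hmono : Monotone fun t : ℝ => 2 * π * t := monotone_mul_left_of_nonneg Real.two_pi_pos.le
  have hvar := (hmono.monotoneOn (Icc 0 1)).eVariationOn_eq (a := 0) (b := 1) (by simp) (by simp)
  rw [inter_self, mul_one, mul_zero, sub_zero] at hvar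
  have hlip := (lipschitzWith_circleMap c R).lipschitzOnWith (s := univ).comp_eVariationOn_le
    (g := fun t : ℝ => 2 * π * t) (s := Icc 0 1) (mapsTo_univ _ _)
  refine hlip.trans_eq ?_
  rw [hvar, Real.nnabs_of_nonneg hR, mul_comm, ENNReal.ofReal_mul Real.two_pi_pos.le]
  rfl

lemma frontier_biUnion_of_isOpen {X ι : Type*} [TopologicalSpace X] (s : Finset ι) {U : ι → Set X}
    (hU : ∀ i ∈ s, IsOpen (U i)) (hd : (s : Set ι).PairwiseDisjoint fun i => closure (U i)) :
    frontier (⋃ i ∈ s, U i) = ⋃ i ∈ s, frontier (U i) := by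
  have hopen : IsOpen (⋃ i ∈ s, U i) := isOpen_biUnion hU
  rw [hopen.frontier_eq, s.closure_biUnion]
  simp only [iUnion_sdiff]
  refine iUnion₂_congr fun i hi => ?_
  rw [(hU i hi).frontier_eq]
  refine subset_antisymm (sdiff_subset_sdiff_right (subset_biUnion_of_mem (u := U) hi))
    fun x hx => ⟨hx.1, fun hxU => ?_⟩
  obtain ⟨j, hj, hxj⟩ := mem_iUnion₂.1 hxU
  rcases eq_or_ne i j with rfl | hij
  · exact hx.2 hxj
  · exact disjoint_left.1 (hd hi hj hij) hx.1 (subset_closure hxj)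

lemma frontier_biUnion_ball (s : Finset ℂ) {R : ℝ} (hR : R ≠ 0)
    (hd : (s : Set ℂ).PairwiseDisjoint fun c => closedBall c R) :
    frontier (⋃ c ∈ s, ball c R) = ⋃ c ∈ s, sphere c R := by
  rw [frontier_biUnion_of_isOpen s (fun c _ => isOpen_ball)]
  · simp only [frontier_ball _ hR]
  · simpa only [closure_ball _ hR] using hd

lemma hasAnalyticBoundaryOfLengthLE_biUnion_ball (s : Finset ℂ) {R : ℝ} (hR : 0 < R)
    (hd : (s : Set ℂ).PairwiseDisjoint fun c => closedBall c R) :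
    HasAnalyticBoundaryOfLengthLE (⋃ c ∈ s, ball c R)
      (ENNReal.ofReal (2 * π * (s.card * R))) := by
  refine ⟨s.card, fun i => unitPeriodCircle (s.equivFin.symm i) R,
    fun i => isAnalyticJordanCurve_unitPeriodCircle _ hR.ne', fun i j hij => ?_, ?_, ?_⟩
  · rw [range_unitPeriodCircle _ hR.le, range_unitPeriodCircle _ hR.le]
    refine (hd (Subtype.coe_prop _) (Subtype.coe_prop _) fun h => hij ?_).mono
      sphere_subset_closedBall sphere_subset_closedBall
    exact s.equivFin.symm.injective (Subtype.ext h)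
  · simp only [frontier_biUnion_ball s hR.ne' hd, range_unitPeriodCircle _ hR.le]
    rw [s.equivFin.symm.surjective.iUnion_comp fun c : s => sphere (c : ℂ) R, iUnion_subtype]
  · refine (Finset.sum_le_sum fun i _ => curveLength_unitPeriodCircle_le _ hR.le).trans_eq ?_
    rw [Finset.sum_const, Finset.card_univ, Fintype.card_fin, nsmul_eq_mul, mul_left_comm,
      ENNReal.ofReal_mul (Nat.cast_nonneg _), ENNReal.ofReal_natCast]

lemma kappa_circlesOfBalls_le_mul {l : ℝ} (hl : 1 < l) (hl' : l < 3 / 2) :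
    kappa circlesOfBalls ≤ ENNReal.ofReal (2 * π * l) := by
  refine sInf_le fun U hU hKU => ?_
  obtain ⟨n, hn⟩ := exists_forall_closedBall_subset (fun _ : Unit => hU)
    (hKU.trans (subset_iUnion (fun _ => U) ())) l
  have hr := radius_pos n
  have hd := pairwiseDisjoint_closedBall_descendants 0 0 n hl.le hl'
  have hcard := card_descendants_mul_radius 0 0 n
  rw [zero_add] at hd hcard
  refine ⟨⋃ c ∈ descendants 0 0 n, ball c (l * radius n), isOpen_biUnion fun _ _ => isOpen_ball,
    ?_, iUnion₂_subset fun c hc => ?_, ?_⟩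
  · exact (circlesOfBalls_subset_biUnion n).trans <| iUnion₂_mono fun c _ =>
      closedBall_subset_ball (lt_mul_of_one_lt_left hr hl)
  · exact ball_subset_closedBall.trans (hn c hc).choose_spec
  · convert hasAnalyticBoundaryOfLengthLE_biUnion_ball (descendants 0 0 n)
      (mul_pos (one_pos.trans hl) hr) hd using 3
    rw [mul_left_comm, hcard, radius, mul_one]

lemma kappa_circlesOfBalls_le : kappa circlesOfBalls ≤ ENNReal.ofReal (2 * π) := by
  have hcont : Continuous fun l => ENNReal.ofReal (2 * π * l) :=
    ENNReal.continuous_ofReal.comp (continuous_const_mul _)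
  have htendsto : Filter.Tendsto (fun l => ENNReal.ofReal (2 * π * l)) (nhdsWithin 1 (Ioi 1))
      (nhds (ENNReal.ofReal (2 * π))) := by
    simpa only [mul_one] using (hcont.tendsto 1).mono_left nhdsWithin_le_nhds
  exact ge_of_tendsto htendsto <|
    Filter.mem_of_superset (Ioo_mem_nhdsGT (by norm_num : (1 : ℝ) < 3 / 2)) fun l hl =>
      kappa_circlesOfBalls_le_mul hl.1 hl.2

end Kappa

end Painleve

theorem mainTheorem4 :
    (∀ k : ℕ, 1 ≤ k → Painleve.level (k + 1) ⊆ Painleve.level k) ∧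
    IsCompact Painleve.circlesOfBalls ∧
    IsTotallyDisconnected Painleve.circlesOfBalls ∧
    μH[1] Painleve.circlesOfBalls = 2 ∧
    Painleve.kappa Painleve.circlesOfBalls = ENNReal.ofReal (2 * π) ∧
    Painleve.kappa Painleve.circlesOfBalls =
      ENNReal.ofReal π * μH[1] Painleve.circlesOfBalls ∧
    (∀ c : ℝ≥0∞,
      (∀ E : Set ℂ, IsCompact E → Painleve.kappa E ≤ c * μH[1] E) → ENNReal.ofReal π ≤ c) := by
  have hμ : μH[1] Painleve.circlesOfBalls = 2 :=
    le_antisymm Painleve.hausdorffMeasure_circlesOfBalls_le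
      Painleve.le_hausdorffMeasure_circlesOfBalls
  have hκ : Painleve.kappa Painleve.circlesOfBalls = ENNReal.ofReal (2 * π) :=
    le_antisymm Painleve.kappa_circlesOfBalls_le Painleve.le_kappa_circlesOfBalls
  have hπ : ENNReal.ofReal (2 * π) = ENNReal.ofReal π * 2 := by
    rw [mul_comm, ENNReal.ofReal_mul Real.pi_pos.le, ENNReal.ofReal_ofNat]
  refine ⟨fun k hk => ?_, Painleve.isCompact_circlesOfBalls,
    Painleve.isTotallyDisconnected_circlesOfBalls, hμ, hκ, by rw [hκ, hμ, hπ], fun c hc => ?_⟩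
  · obtain ⟨d, rfl⟩ := Nat.exists_eq_add_of_le' hk
    exact Painleve.level_succ_subset d
  · have h := hc _ Painleve.isCompact_circlesOfBalls
    rw [hκ, hμ, hπ] at h
    exact (ENNReal.mul_le_mul_iff_left two_ne_zero (by simp)).1 h
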